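/- Let $\mathbb F$ be a finite field and let $d,q\ge 0$ be integers. Let $A(X)=\sum_{i=0}^d a_iX^i$ be a random polynomial of degree at most $d$, with coefficients $a_0,\dots,a_d$ independent and uniform in $\mathbb F$. A $q$-query quantum algorithm has access to $A$ on $\mathbb F\setminus\{0\}$ only, through phase queries, i.e. the unitary $|x,\xi,z\rangle\mapsto \xi(A(x))\,|x,\xi,z\rangle$, where $x\in\mathbb F\setminus\{0\}$, $\xi$ is a character of $(\mathbb F,+)$, and $z$ is a workspace register of arbitrary finite dimension. It starts in a fixed state, makes $q$ sequential queries, each followed by a unitary independent of $A$, and finally measures to output an element of $\mathbb F$. It succeeds if the output equals $A(0)$; its success probability is taken over the choice of $A$ and the measurement. Then, for each $d$ and $q$, the maximum $P$ of the success probabilities of all $q$-query quantum algorithms exists, and it satisfies the following. 1. If $q\le d/2$, then $P=\dfrac1{|\mathbb F|}$. 2. If $q=(d+1)/2$ and $q\le|\mathbb F|-1$, then $P\le\dfrac{\lfloor(|\mathbb F|-1)/q\rfloor}{|\mathbb F|}$, with equality whenever $q$ divides $|\mathbb F|-1$. 3. If $q\ge(d+2)/2$, then $P\ge 1-\dfrac{(\lfloor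 d/2\rfloor+1)!+d+1}{|\mathbb F|}$. -/

import Mathlib

open scoped Nat

noncomputable section

/-- The computational basis of the state space of a quantum algorithm that queries an oracle
`X → G` in the phase model: a query input `x`, a character `ξ` of `G`, and a workspace of
arbitrary finite dimension `k`. -/
abbrev QBasis (X G : Type*) [AddCommGroup G] (k : ℕ) : Type _ :=
  X × AddChar G ℂ × Fin k

/-- The state space: the Hilbert space with orthonormal basis `|x, ξ, z⟩`. -/
abbrev QState (X G : Type*) [AddCommGroup G] (k : ℕ) : Type _ :=
  EuclideanSpace ℂ (QBasis X G k)

/-- The phase query to `A`: `|x, ξ, z⟩ ↦ ξ(A x) |x, ξ, z⟩`, extended linearly. -/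
def phaseQuery {X G : Type*} [AddCommGroup G] {k : ℕ} (A : X → G) (ψ : QState X G k) :
    QState X G k :=
  WithLp.toLp 2 fun b => b.2.1 (A b.1) * ψ b

/-- A quantum oracle algorithm with outputs in `O`: a unit initial state, the
(oracle-independent) unitary applied after the `i`-th query, for each `i`, and a classical
decoding of the outcome of a measurement in the computational basis. As the workspace is
arbitrary, this covers mixed initial states, intermediate measurements and general final
measurements. -/
structure QAlgorithm (X G O : Type*) [Fintype X] [AddCommGroup G] [Finite G] where
  /-- the dimension of the workspace -/
  workDim : ℕ
  /-- the initial state -/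
  init : QState X G workDim
  norm_init : ‖init‖ = 1
  /-- the unitary applied after each query -/
  step : ℕ → (QState X G workDim ≃ₗᵢ[ℂ] QState X G workDim)
  /-- the output announced for each measurement outcome -/
  decode : QBasis X G workDim → O

namespace QAlgorithm

variable {X G O : Type*} [Fintype X] [AddCommGroup G] [Finite G]

/-- The state after `q` (sequential) queries to the oracle `A`. -/
def run (Q : QAlgorithm X G O) (A : X → G) : ℕ → QState X G Q.workDim
  | 0 => Q.init
  | i + 1 => Q.step i (phaseQuery A (Q.run A i))

/-- The probability that the algorithm outputs `o` after `q` queries to the oracle `A`. -/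
def outputProb [DecidableEq O] (Q : QAlgorithm X G O) (q : ℕ) (A : X → G) (o : O) : ℝ :=
  ∑ b : QBasis X G Q.workDim, if Q.decode b = o then ‖Q.run A q b‖ ^ 2 else 0

end QAlgorithm

/-- The polynomial `∑ i, a i * X ^ i` of degree at most `d`. -/
def polyOfCoeffs {F : Type*} [Field F] {d : ℕ} (a : Fin (d + 1) → F) : Polynomial F :=
  ∑ i : Fin (d + 1), Polynomial.monomial (i : ℕ) (a i)

/-- The probability that `Q`, making `q` queries to a uniformly random polynomial `A` of degree
at most `d` on the nonzero elements of the finite field `F`, outputs `A(0)`. -/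
def extrapolationProb {F : Type*} [Field F] [Fintype F] [DecidableEq F]
    (d q : ℕ) (Q : QAlgorithm {x : F // x ≠ 0} F F) : ℝ :=
  (∑ a : Fin (d + 1) → F,
      Q.outputProb q (fun x => (polyOfCoeffs a).eval (x : F)) ((polyOfCoeffs a).eval 0)) /
    (Fintype.card (Fin (d + 1) → F) : ℝ)

/-- `P` is the maximum success probability of a `q`-query quantum algorithm for extrapolating a
random polynomial of degree at most `d` over `F` to `0`. -/
def IsMaxExtrapolationProb (F : Type*) [Field F] [Fintype F] [DecidableEq F]
    (d q : ℕ) (P : ℝ) : Prop :=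
  IsGreatest (Set.range fun Q : QAlgorithm {x : F // x ≠ 0} F F => extrapolationProb d q Q) P

end

/-! Fix a primitive character `e` of `F`. Every query multiplies a basis state by some `e (c * A
x)`, which is a character of the coefficient vector `a`. Hence after `q` queries the state is `∑ w,
e (w ⬝ᵥ a) • Φ w`, where `w` runs over the vectors of moments `∑ f x * x ^ j`, `j ≤ d`, of weights
`f` on at most `q` nonzero points (`exists_amplitudes`).

Write `w = (y, u)` with `y` dual to `a 0 = A(0)`. Averaging over the other coefficients makes
different `u` orthogonal, and for one `u` only the `y` in `fiber d q u` occur, so Cauchy–Schwarz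
bounds the success probability by `maxFiber F d q / |F|` (`extrapolationProb_le`). A uniform
superposition over a largest fiber, followed by a Fourier transform, attains this
(`exists_le_extrapolationProb`). It remains to count how many zeroth moments are possible when the
moments of order `1, …, d` are prescribed.

By a Vandermonde argument, distinct weights with equal moments of order `1, …, d` have more than `d`
points in the union of their supports (`lt_card_fsupp_union`). If `2q ≤ d` there is no room for
this, so fibers are singletons. If `2q = d + 1` and a fiber has several elements, they have disjoint
supports of exactly `q` points, which gives the packing bound; cosets of the `q`-th roots of unity
attain it. For larger `q` a second moment argument applies to weights with exactly `k = d / 2 + 1`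
support points: collisions of their first `2k - 1` moments are rare, so over a large field most
moment vectors occur and by pigeonhole some fiber is large. For odd `d` one extra query at the point
`1` raises the degree by one (`card_innerFiber_le_maxFiber`). -/

open Finset

/-! ### Moments of sparse weights; the cases `2q ≤ d` and `2q = d + 1` -/

section Moments

variable {F : Type*} [Field F] [Fintype F]

/-- The `j`-th moment of a weight function on a finite field. -/
def moment (f : F → F) (j : ℕ) : F := ∑ x, f x * x ^ j

lemma moment_sub (f g : F → F) (j : ℕ) : moment (f - g) j = moment f j - moment g j := by
  simp [moment, sub_mul, Finset.sum_sub_distrib]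

lemma moment_add (f g : F → F) (j : ℕ) : moment (f + g) j = moment f j + moment g j := by
  simp [moment, add_mul, Finset.sum_add_distrib]

variable [DecidableEq F]

/-- The support of a function on a finite type, as a finset. -/
def fsupp {F : Type*} [Zero F] [Fintype F] [DecidableEq F] (f : F → F) : Finset F :=
  univ.filter fun x => f x ≠ 0

@[simp] lemma mem_fsupp {f : F → F} {x : F} : x ∈ fsupp f ↔ f x ≠ 0 := by simp [fsupp]

lemma moment_single (x c : F) (j : ℕ) : moment (Pi.single x c) j = c * x ^ j := by
  simp [moment, Pi.single_apply]

lemma fsupp_sub_subset (f g : F → F) : fsupp (f - g) ⊆ fsupp f ∪ fsupp g := by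
  intro x
  simp only [mem_fsupp, mem_union, Pi.sub_apply]
  contrapose!
  rintro ⟨h1, h2⟩
  simp [h1, h2]

lemma fsupp_add_subset (f g : F → F) : fsupp (f + g) ⊆ fsupp f ∪ fsupp g := by
  intro x
  simp only [mem_fsupp, mem_union, Pi.add_apply]
  contrapose!
  rintro ⟨h1, h2⟩
  simp [h1, h2]

lemma fsupp_single_subset (x c : F) : fsupp (Pi.single x c : F → F) ⊆ {x} := by
  intro y
  simp only [mem_fsupp, mem_singleton]
  contrapose!
  intro h
  simp [h]

/-- A weight function with at most `n` points in its support and `n` vanishing moments is zero. -/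
lemma eq_zero_of_moment_eq_zero {f : F → F} {n : ℕ} (hs : #(fsupp f) ≤ n)
    (hm : ∀ j < n, moment f j = 0) : f = 0 := by
  have key : ∀ p : Polynomial F, p.natDegree < n → ∑ x, f x * p.eval x = 0 := by
    intro p hp
    simp_rw [Polynomial.eval_eq_sum_range' hp, Finset.mul_sum]
    rw [Finset.sum_comm]
    refine Finset.sum_eq_zero fun j hj => ?_
    have := hm j (Finset.mem_range.1 hj)
    rw [moment] at this
    calc ∑ x, f x * (p.coeff j * x ^ j) = p.coeff j * ∑ x, f x * x ^ j := by
          rw [Finset.mul_sum]; exact Finset.sum_congr rfl fun x _ => by ring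
      _ = 0 := by rw [this, mul_zero]
  ext x
  by_contra hx
  have hx' : x ∈ fsupp f := by simpa using hx
  -- Pairing `f` with a polynomial that vanishes on the rest of its support isolates the value at
  -- `x`.
  set p : Polynomial F := ∏ y ∈ (fsupp f).erase x, (Polynomial.X - Polynomial.C y) with hp
  have hdeg : p.natDegree < n := by
    rw [hp, Polynomial.natDegree_finsetProd_X_sub_C_eq_card, Finset.card_erase_of_mem hx']
    have : 0 < #(fsupp f) := Finset.card_pos.2 ⟨x, hx'⟩
    omega
  have h := key p hdeg
  rw [Finset.sum_eq_single x] at h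
  · rcases mul_eq_zero.1 h with h | h
    · exact hx h
    · rw [hp, Polynomial.eval_prod, Finset.prod_eq_zero_iff] at h
      obtain ⟨y, hy, h⟩ := h
      simp only [Polynomial.eval_sub, Polynomial.eval_X, Polynomial.eval_C, sub_eq_zero] at h
      exact (Finset.mem_erase.1 hy).1 h.symm
  · intro y _ hy
    by_cases hfy : f y = 0
    · simp [hfy]
    · rw [hp, Polynomial.eval_prod, Finset.prod_eq_zero (i := y), mul_zero]
      · exact Finset.mem_erase.2 ⟨hy, by simpa using hfy⟩
      · simp
  · simp

/-- Version of `eq_zero_of_moment_eq_zero` with shifted moments. -/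
lemma eq_zero_of_moment_succ_eq_zero {f : F → F} {n : ℕ} (h0 : f 0 = 0) (hs : #(fsupp f) ≤ n)
    (hm : ∀ j < n, moment f (j + 1) = 0) : f = 0 := by
  have : (fun x => f x * x) = 0 := by
    refine eq_zero_of_moment_eq_zero (n := n) ((Finset.card_le_card ?_).trans hs) fun j hj => ?_
    · intro x
      simp only [mem_fsupp]
      exact left_ne_zero_of_mul
    · rw [← hm j hj]
      exact Finset.sum_congr rfl fun x _ => by ring
  ext x
  have hx := congrFun this x
  rcases mul_eq_zero.1 hx with h | h
  · exact h
  · rw [h, h0]; rfl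

/-- The weights supported on at most `q` nonzero points: these are the combinations of
evaluations at nonzero points that `q` queries can reach. -/
def Sparse (q : ℕ) (f : F → F) : Prop := f 0 = 0 ∧ #(fsupp f) ≤ q

/-- The set of zeroth moments of `q`-sparse weights whose moments of order `1, …, d` are `u`. -/
noncomputable def fiber (d q : ℕ) (u : Fin d → F) : Finset F :=
  open Classical in
  univ.filter fun y => ∃ f : F → F, Sparse q f ∧ moment f 0 = y ∧
    ∀ j : Fin d, moment f (j + 1) = u j

lemma mem_fiber {d q : ℕ} {u : Fin d → F} {y : F} : y ∈ fiber d q u ↔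
    ∃ f : F → F, Sparse q f ∧ moment f 0 = y ∧ ∀ j : Fin d, moment f (j + 1) = u j := by
  simp [fiber]

lemma fiber_mono {d q q' : ℕ} (h : q ≤ q') (u : Fin d → F) : fiber d q u ⊆ fiber d q' u := by
  intro y
  simp only [mem_fiber]
  rintro ⟨f, hf, h1⟩
  exact ⟨f, ⟨hf.1, hf.2.trans h⟩, h1⟩

/-- The largest size of a fiber. -/
noncomputable def maxFiber (F : Type*) [Field F] [Fintype F] [DecidableEq F] (d q : ℕ) : ℕ :=
  univ.sup fun u : Fin d → F => #(fiber d q u)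

lemma card_fiber_le_maxFiber {d q : ℕ} (u : Fin d → F) : #(fiber d q u) ≤ maxFiber F d q :=
  Finset.le_sup (f := fun u : Fin d → F => #(fiber d q u)) (mem_univ u)

lemma exists_card_fiber_eq (d q : ℕ) : ∃ u : Fin d → F, #(fiber d q u) = maxFiber F d q := by
  obtain ⟨u, -, hu⟩ := Finset.exists_mem_eq_sup univ univ_nonempty
    (fun u : Fin d → F => #(fiber d q u))
  exact ⟨u, hu.symm⟩

lemma maxFiber_pos (d q : ℕ) : 0 < maxFiber F d q := by
  refine lt_of_lt_of_le ?_ (card_fiber_le_maxFiber (0 : Fin d → F))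
  refine Finset.card_pos.2 ⟨0, mem_fiber.2 ⟨0, ⟨rfl, ?_⟩, ?_, ?_⟩⟩ <;> simp [moment, fsupp]

lemma maxFiber_mono {d q q' : ℕ} (h : q ≤ q') : maxFiber F d q ≤ maxFiber F d q' := by
  obtain ⟨u, hu⟩ := exists_card_fiber_eq (F := F) d q
  rw [← hu]
  exact (Finset.card_le_card (fiber_mono h u)).trans (card_fiber_le_maxFiber u)

/-- Distinct weights with the same moments of order `1, …, d` differ at more than `d` points. -/
lemma lt_card_fsupp_union {d : ℕ} {f g : F → F} (hf : f 0 = 0) (hg : g 0 = 0) (hne : f ≠ g)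
    (h : ∀ j : Fin d, moment f (j + 1) = moment g (j + 1)) :
    d < #(fsupp f ∪ fsupp g) := by
  by_contra! hle
  refine hne (sub_eq_zero.1 (eq_zero_of_moment_succ_eq_zero (n := d) (by simp [hf, hg])
    ((Finset.card_le_card (fsupp_sub_subset f g)).trans hle) fun j hj => ?_))
  rw [moment_sub, h ⟨j, hj⟩, sub_self]

/-- The union of two `q`-point supports has at most `2q ≤ d` points, too few for distinct weights
with the same moments. -/
lemma maxFiber_eq_one {d q : ℕ} (h : 2 * q ≤ d) : maxFiber F d q = 1 := by
  refine le_antisymm (Finset.sup_le fun u _ => Finset.card_le_one.2 ?_) (maxFiber_pos d q)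
  intro y hy y' hy'
  obtain ⟨f, hf, rfl, hfu⟩ := mem_fiber.1 hy
  obtain ⟨g, hg, rfl, hgu⟩ := mem_fiber.1 hy'
  by_contra hne
  have h1 := lt_card_fsupp_union hf.1 hg.1 (fun h => hne (by rw [h]))
    (fun j : Fin d => (hfu j).trans (hgu j).symm)
  have h2 := Finset.card_union_le (fsupp f) (fsupp g)
  have := hf.2
  have := hg.2
  omega

/-- Any two weights of one fiber need `2q` points in the union of their supports, so the supports
are disjoint `q`-subsets of the nonzero elements. -/
lemma maxFiber_le_div {d q : ℕ} (h : 2 * q = d + 1) (hq : q ≤ Fintype.card F - 1) :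
    maxFiber F d q ≤ (Fintype.card F - 1) / q := by
  have hq0 : 0 < q := by omega
  obtain ⟨u, hu⟩ := exists_card_fiber_eq (F := F) d q
  rw [← hu, Nat.le_div_iff_mul_le hq0]
  rcases Nat.lt_or_ge 1 #(fiber d q u) with h1 | h1
  swap
  -- For a fiber with at most one element, `hq` says that the quotient is at least `1`.
  · exact (Nat.mul_le_mul_right q h1).trans (by simpa using hq)
  have hex : ∀ y : fiber d q u, ∃ f : F → F, Sparse q f ∧ moment f 0 = y ∧
    ∀ j : Fin d, moment f (j + 1) = u j := fun y => mem_fiber.1 y.2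
  choose f hf hf0 hfu using hex
  have key : ∀ y y' : fiber d q u, y ≠ y' → 2 * q ≤ #(fsupp (f y) ∪ fsupp (f y')) := by
    intro y y' hne
    have := lt_card_fsupp_union (hf y).1 (hf y').1
      (fun h => hne (Subtype.ext (by rw [← hf0 y, ← hf0 y', h])))
      (fun j : Fin d => (hfu y j).trans (hfu y' j).symm)
    omega
  have hdisj : ∀ y y' : fiber d q u, y ≠ y' → Disjoint (fsupp (f y)) (fsupp (f y')) := by
    intro y y' hne
    have h2 := key y y' hne
    have h3 := Finset.card_union_add_card_inter (fsupp (f y)) (fsupp (f y'))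
    have := (hf y).2
    have := (hf y').2
    rw [Finset.disjoint_iff_inter_eq_empty, ← Finset.card_eq_zero]
    omega
  have hcard : ∀ y : fiber d q u, #(fsupp (f y)) = q := by
    intro y
    obtain ⟨y', hy', hne⟩ := Finset.exists_mem_ne h1 (y : F)
    have h2 := key y ⟨y', hy'⟩ (fun h => hne (by rw [h]))
    have h3 := Finset.card_union_le (fsupp (f y)) (fsupp (f ⟨y', hy'⟩))
    have := (hf y).2
    have := (hf ⟨y', hy'⟩).2
    omega
  have hsub : (univ : Finset (fiber d q u)).biUnion (fun y => fsupp (f y)) ⊆ univ.erase 0 := by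
    intro x hx
    obtain ⟨y, -, hy⟩ := Finset.mem_biUnion.1 hx
    refine Finset.mem_erase.2 ⟨fun h => ?_, mem_univ _⟩
    rw [h, mem_fsupp, (hf y).1] at hy
    exact hy rfl
  have := Finset.card_le_card hsub
  rw [Finset.card_biUnion (fun y _ y' _ hne => hdisj y y' hne),
    Finset.card_erase_of_mem (mem_univ _), Finset.sum_congr rfl (fun y _ => hcard y)] at this
  simpa using this

/-- For each nonzero `q`-th power `r`, put the constant weight `r / q` on the `q` roots of `x ^ q =
r⁻¹`. The zeroth moment is `r`, the `q`-th is `1`, and the others of order up to `d = 2q - 1` vanish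
by invariance under a primitive `q`-th root of unity. So all `(|F| - 1) / q` values `r` lie in one
fiber. -/
lemma div_le_maxFiber {d q : ℕ} (h : 2 * q = d + 1) (hq : q ∣ Fintype.card F - 1) :
    (Fintype.card F - 1) / q ≤ maxFiber F d q := by
  have hq0 : 0 < q := by omega
  have hcardU : Nat.card Fˣ = Fintype.card F - 1 := by
    rw [Nat.card_eq_fintype_card, Fintype.card_units]
  have hgcd : (Nat.card Fˣ).gcd q = q := by rw [hcardU]; exact Nat.gcd_eq_right hq
  have hF : 0 < Fintype.card F - 1 := Nat.sub_pos_of_lt Fintype.one_lt_card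
  have hqF : (q : F) ≠ 0 := by
    obtain ⟨c, hc⟩ := hq
    intro h0
    have h1 : ((Fintype.card F - 1 : ℕ) : F) = 0 := by rw [hc]; simp [h0]
    rw [Nat.cast_sub Fintype.card_pos, FiniteField.cast_card_eq_zero] at h1
    simp at h1
  have hker : Nat.card (powMonoidHom q : Fˣ →* Fˣ).ker = q := by
    rw [IsCyclic.card_powMonoidHom_ker, hgcd]
  obtain ⟨ζ, hζ⟩ : ∃ ζ : Fˣ, orderOf ζ = q := by
    obtain ⟨g, hg⟩ := IsCyclic.exists_generator (α := Fˣ)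
    have hg' := orderOf_eq_card_of_forall_mem_zpowers hg
    refine ⟨g ^ (Nat.card Fˣ / q), ?_⟩
    rw [orderOf_pow, hg']
    have h2 : q ∣ Nat.card Fˣ := by rwa [hcardU]
    obtain ⟨c, hc⟩ := h2
    have hc0 : 0 < c := Nat.pos_of_ne_zero (by rintro rfl; rw [hcardU] at hc; omega)
    rw [hc, Nat.mul_div_cancel_left _ hq0, Nat.gcd_eq_right (Dvd.intro_left q rfl),
      Nat.mul_div_cancel _ hc0]
  set R := (powMonoidHom q : Fˣ →* Fˣ).range with hR
  have hRcard : Nat.card R = (Fintype.card F - 1) / q := by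
    rw [hR, IsCyclic.card_powMonoidHom_range, hgcd, hcardU]
  have hex : ∃ j : Fin d, (j : ℕ) + 1 = q := ⟨⟨q - 1, by omega⟩, by simp; omega⟩
  obtain ⟨j₀, hj₀⟩ := hex
  refine le_trans ?_ (card_fiber_le_maxFiber (Pi.single j₀ 1 : Fin d → F))
  rw [← hRcard, Nat.card_eq_fintype_card, ← Finset.card_univ]
  refine Finset.card_le_card_of_injOn (fun r : R => (((r : Fˣ) : F))) ?_
    (fun a _ b _ hab => Subtype.ext (Units.ext hab))
  rintro ⟨r, a, ha⟩ -
  simp only [powMonoidHom_apply] at ha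
  have ha0 : (a : F) ≠ 0 := a.ne_zero
  have har : (a : F) ^ q = r := by rw [← ha]; simp
  have hr0 : (r : F) ≠ 0 := r.ne_zero
  -- the `q`-th roots of `r⁻¹`
  set T : Finset F := univ.filter fun x => x ^ q = (r : F)⁻¹ with hT
  have hTcard : #T = q := by
    -- `T` is the translate by `a⁻¹` of the group of `q`-th roots of unity.
    conv_rhs => rw [← hker, Nat.card_eq_fintype_card, ← Finset.card_univ]
    refine (Finset.card_bij (s := (univ : Finset (powMonoidHom q : Fˣ →* Fˣ).ker)) (t := T)
      (fun x _ => ((x : Fˣ) : F) * (a : F)⁻¹) ?_ ?_ ?_).symm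
    · rintro ⟨x, hx⟩ -
      have hx' : x ^ q = 1 := hx
      have hx2 : (x : F) ^ q = 1 := by rw [← Units.val_pow_eq_pow_val, hx']; simp
      simp [hT, mul_pow, hx2, har]
    · rintro ⟨x, hx⟩ - ⟨y, hy⟩ - hxy
      exact Subtype.ext (Units.ext (mul_right_cancel₀ (inv_ne_zero ha0) hxy))
    · intro x hx
      have hx' : x ^ q = (r : F)⁻¹ := by simpa [hT] using hx
      have hx1 : (x * a) ^ q = 1 := by rw [mul_pow, hx', har, inv_mul_cancel₀ hr0]
      have hx0 : x * a ≠ 0 := by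
        intro h0
        rw [h0, zero_pow hq0.ne'] at hx1
        exact zero_ne_one hx1
      refine ⟨⟨Units.mk0 _ hx0, ?_⟩, mem_univ _, ?_⟩
      · rw [MonoidHom.mem_ker, powMonoidHom_apply]
        exact Units.ext (by simpa using hx1)
      · simp [ha0]
  have hmom : ∀ j : ℕ, moment (fun x => if x ∈ T then (r : F) / q else 0) j =
      (r : F) / q * ∑ x ∈ T, x ^ j := by
    intro j
    rw [moment, Finset.mul_sum]
    simp_rw [ite_mul, zero_mul]
    rw [Finset.sum_ite_mem, univ_inter]
  refine Finset.mem_coe.2 (mem_fiber.2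
    ⟨fun x => if x ∈ T then (r : F) / q else 0, ⟨?_, ?_⟩, ?_, fun j => ?_⟩)
  · simp [hT, hq0.ne', hr0.symm]
  · rw [← hTcard]
    refine Finset.card_le_card fun x hx => ?_
    rw [mem_fsupp] at hx
    by_contra hxT
    simp [hxT] at hx
  · rw [hmom]
    simp [hTcard, hqF]
  · rw [hmom]
    by_cases hj : j = j₀
    · subst hj
      rw [hj₀, Finset.sum_congr rfl (fun x hx => (Finset.mem_filter.1 hx).2)]
      rw [Finset.sum_const, hTcard, nsmul_eq_mul, Pi.single_eq_same]
      field_simp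
    · rw [Pi.single_eq_of_ne hj]
      have hne : ((ζ : F)) ^ ((j : ℕ) + 1) ≠ 1 := by
        intro h1
        have h2 : ζ ^ ((j : ℕ) + 1) = 1 := Units.ext (by simpa using h1)
        have h3 := orderOf_dvd_of_pow_eq_one h2
        rw [hζ] at h3
        obtain ⟨c, hc⟩ := h3
        have := j.2
        -- As `j + 1 ≤ d < 2q`, the only multiple of `q` in range is `q` itself.
        have hc2 : c < 2 := by
          by_contra! hc2
          have := Nat.mul_le_mul_left q hc2
          omega
        have hc1 : c = 1 := by
          interval_cases c
          · omega
          · rfl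
        subst hc1
        exact hj (Fin.ext (by omega))
      have hζq : (ζ : F) ^ q = 1 := by
        rw [← Units.val_pow_eq_pow_val, ← hζ, pow_orderOf_eq_one]; simp
      have hsum : ∑ x ∈ T, x ^ ((j : ℕ) + 1) = (ζ : F) ^ ((j : ℕ) + 1) *
          ∑ x ∈ T, x ^ ((j : ℕ) + 1) := by
        rw [Finset.mul_sum]
        symm
        refine Finset.sum_bij (fun x _ => (ζ : F) * x) ?_ ?_ ?_ ?_
        · intro x hx
          simp only [hT, mem_filter, mem_univ, true_and] at hx ⊢
          rw [mul_pow, hζq, one_mul, hx]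
        · intro x _ y _ hxy
          exact mul_left_cancel₀ ζ.ne_zero hxy
        · intro x hx
          refine ⟨(ζ : F)⁻¹ * x, ?_, ?_⟩
          · simp only [hT, mem_filter, mem_univ, true_and] at hx ⊢
            rw [mul_pow, inv_pow, hζq, inv_one, one_mul, hx]
          · rw [mul_inv_cancel_left₀ ζ.ne_zero]
        · intro x _
          rw [mul_pow]
      have h0 : ((ζ : F) ^ ((j : ℕ) + 1) - 1) * ∑ x ∈ T, x ^ ((j : ℕ) + 1) = 0 := by
        rw [sub_mul, one_mul, ← hsum, sub_self]
      rcases mul_eq_zero.1 h0 with h0 | h0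
      · exact absurd (sub_eq_zero.1 h0) hne
      · rw [h0, mul_zero]

end Moments

/-! ### Second moment method for weights with exactly `k` support points -/

section Counting

variable {F : Type*} [Field F] [Fintype F] [DecidableEq F]

/-- The weights whose support consists of exactly `k` points of `P`. -/
def exactWeights (P : Finset F) (k : ℕ) : Finset (F → F) :=
  univ.filter fun f => fsupp f ⊆ P ∧ #(fsupp f) = k

lemma mem_exactWeights {P : Finset F} {k : ℕ} {f : F → F} :
    f ∈ exactWeights P k ↔ fsupp f ⊆ P ∧ #(fsupp f) = k := by simp [exactWeights]

lemma card_filter_fsupp_eq (T : Finset F) :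
    #(univ.filter fun f : F → F => fsupp f = T) = (Fintype.card F - 1) ^ #T := by
  have : (univ.filter fun f : F → F => fsupp f = T) =
      Fintype.piFinset fun x => if x ∈ T then univ.erase (0 : F) else {0} := by
    ext f
    simp only [mem_filter, mem_univ, true_and, Fintype.mem_piFinset, Finset.ext_iff, mem_fsupp]
    refine forall_congr' fun x => ?_
    by_cases hx : x ∈ T <;> simp [hx]
  rw [this, Fintype.card_piFinset, Finset.prod_congr rfl
    (g := fun x => if x ∈ T then Fintype.card F - 1 else 1)]
  · rw [Finset.prod_ite_mem, univ_inter, Finset.prod_const]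
  · intro x _
    split_ifs
    · rw [Finset.card_erase_of_mem (mem_univ _), Finset.card_univ]
    · simp

lemma card_exactWeights (P : Finset F) (k : ℕ) :
    #(exactWeights P k) = (#P).choose k * (Fintype.card F - 1) ^ k := by
  rw [← Finset.card_powersetCard, Finset.card_eq_sum_card_fiberwise (f := fsupp)
    (t := P.powersetCard k)]
  · rw [Finset.sum_congr rfl (g := fun _ => (Fintype.card F - 1) ^ k), Finset.sum_const,
      smul_eq_mul]
    intro T hT
    rw [Finset.mem_powersetCard] at hT
    rw [← hT.2, ← card_filter_fsupp_eq T]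
    congr 1
    ext f
    simp only [mem_filter, mem_exactWeights, mem_univ, true_and]
    constructor
    · exact fun h => h.2
    · intro h
      rw [h]
      exact ⟨⟨hT.1, rfl⟩, rfl⟩
  · intro f hf
    exact Finset.mem_powersetCard.2 (mem_exactWeights.1 hf)

/-- The first `n` moments of a weight. -/
def momentVec (n : ℕ) (f : F → F) : Fin n → F := fun j => moment f j

lemma eq_zero_of_momentVec_eq {n : ℕ} {f g : F → F} (hs : #(fsupp (f - g)) ≤ n)
    (h : momentVec n f = momentVec n g) : f = g := by
  refine sub_eq_zero.1 (eq_zero_of_moment_eq_zero hs fun j hj => ?_)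
  rw [moment_sub, sub_eq_zero]
  exact congrFun h ⟨j, hj⟩

/-- A nonzero `f - g` with `2k - 1` vanishing moments needs `2k` support points, which leaves no
overlap. -/
lemma disjoint_fsupp_of_momentVec_eq {P : Finset F} {k : ℕ} {f g : F → F}
    (hf : f ∈ exactWeights P k) (hg : g ∈ exactWeights P k) (hne : f ≠ g)
    (h : momentVec (2 * k - 1) f = momentVec (2 * k - 1) g) : Disjoint (fsupp f) (fsupp g) := by
  rw [mem_exactWeights] at hf hg
  by_contra hd
  rw [Finset.disjoint_iff_inter_eq_empty, ← Finset.card_eq_zero] at hd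
  refine hne (eq_zero_of_momentVec_eq ?_ h)
  have h1 := Finset.card_le_card (fsupp_sub_subset f g)
  have h3 := Finset.card_union_add_card_inter (fsupp f) (fsupp g)
  omega

/-- There are few pairs of distinct weights with the same moments. -/
lemma card_collisions_le (P : Finset F) {k : ℕ} (hk : 0 < k) :
    #((exactWeights P k ×ˢ exactWeights P k).filter fun p => p.1 ≠ p.2 ∧
      momentVec (2 * k - 1) p.1 = momentVec (2 * k - 1) p.2) ≤
    (#P).choose k * (#P).choose k * (Fintype.card F - 1) := by
  classical
  -- On two given disjoint supports, `2k - 1` moment equations in `2k` unknowns leave one degree of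
  -- freedom. The value at one chosen support point fixes it, and that value is nonzero.
  set pt : Finset F → F := fun T => if h : T.Nonempty then h.choose else 0 with hpt
  have hptmem : ∀ f ∈ exactWeights P k, pt (fsupp f) ∈ fsupp f := by
    intro f hf
    have hne : (fsupp f).Nonempty := by
      rw [← Finset.card_pos, (mem_exactWeights.1 hf).2]; exact hk
    rw [hpt]
    simp only [hne, dif_pos]
    exact hne.choose_spec
  have hcard : (#P).choose k * (#P).choose k * (Fintype.card F - 1) =
      #((P.powersetCard k ×ˢ P.powersetCard k) ×ˢ (univ.erase (0 : F))) := by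
    rw [card_product, card_product, card_powersetCard, Finset.card_erase_of_mem (mem_univ _),
      Finset.card_univ]
  rw [hcard]
  refine Finset.card_le_card_of_injOn
    (fun p => ((fsupp p.1, fsupp p.2), p.1 (pt (fsupp p.1)))) ?_ ?_
  · rintro ⟨f, g⟩ h
    simp only [coe_filter, mem_product, Set.mem_ofPred_eq] at h
    simp only [mem_coe, mem_product, mem_powersetCard, mem_erase, mem_univ, and_true]
    exact ⟨⟨mem_exactWeights.1 h.1.1, mem_exactWeights.1 h.1.2⟩, mem_fsupp.1 (hptmem f h.1.1)⟩
  · rintro ⟨f, g⟩ h ⟨f', g'⟩ h' heq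
    simp only [coe_filter, mem_product, Set.mem_ofPred_eq] at h h'
    simp only [Prod.mk.injEq] at heq
    obtain ⟨⟨⟨hf, hg⟩, hne, hm⟩, ⟨⟨hf', hg'⟩, hne', hm'⟩⟩ := And.intro h h'
    obtain ⟨⟨hff, hgg⟩, hv⟩ := heq
    have hd := disjoint_fsupp_of_momentVec_eq hf hg hne hm
    have hx := hptmem f hf
    set x := pt (fsupp f) with hxdef
    rw [← hff, ← hxdef] at hv
    -- `f - g` and `f' - g'` live on the same `2k` points and agree at `x`, so their difference has
    -- at most `2k - 1` support points and `2k - 1` vanishing moments.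
    have hzero : f - f' = g - g' := by
      refine eq_zero_of_momentVec_eq (n := 2 * k - 1) ?_ ?_
      · have hsub : fsupp (f - f' - (g - g')) ⊆ (fsupp f ∪ fsupp g).erase x := by
          intro y hy
          refine Finset.mem_erase.2 ⟨?_, ?_⟩
          · rintro rfl
            have hxg : x ∉ fsupp g := Finset.disjoint_left.1 hd hx
            have hxg' : x ∉ fsupp g' := hgg ▸ hxg
            rw [mem_fsupp, not_not] at hxg hxg'
            rw [mem_fsupp] at hy
            simp [hxg, hxg', hv] at hy
          · have := fsupp_sub_subset _ _ hy
            rcases Finset.mem_union.1 this with h | h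
            · have := fsupp_sub_subset _ _ h
              rw [← hff, union_self] at this
              exact mem_union_left _ this
            · have := fsupp_sub_subset _ _ h
              rw [← hgg, union_self] at this
              exact mem_union_right _ this
        refine (Finset.card_le_card hsub).trans ?_
        rw [Finset.card_erase_of_mem (mem_union_left _ hx), Finset.card_union_of_disjoint hd,
          (mem_exactWeights.1 hf).2, (mem_exactWeights.1 hg).2]
        omega
      · ext j
        have h1 := congrFun hm j
        have h2 := congrFun hm' j
        simp only [momentVec] at h1 h2 ⊢
        rw [moment_sub, moment_sub, h1, h2]
    have hdisj : ∀ y, f y = f' y ∧ g y = g' y := by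
      intro y
      have hy := congrFun hzero y
      simp only [Pi.sub_apply] at hy
      by_cases hyf : y ∈ fsupp f
      · have hyg : y ∉ fsupp g := Finset.disjoint_left.1 hd hyf
        have hyg' : y ∉ fsupp g' := hgg ▸ hyg
        rw [mem_fsupp, not_not] at hyg hyg'
        rw [hyg, hyg', sub_self, sub_eq_zero] at hy
        exact ⟨hy, by rw [hyg, hyg']⟩
      · have hyf' : y ∉ fsupp f' := hff ▸ hyf
        rw [mem_fsupp, not_not] at hyf hyf'
        rw [hyf, hyf', sub_self, eq_comm, sub_eq_zero] at hy
        exact ⟨by rw [hyf, hyf'], hy⟩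
    exact Prod.ext (funext fun y => (hdisj y).1) (funext fun y => (hdisj y).2)

/-- Cauchy–Schwarz on the sizes of the fibers of `f`: the sum of their squares counts colliding
pairs, diagonal included. -/
lemma sq_card_le_card_image_mul {α β : Type*} [DecidableEq α] [DecidableEq β] (s : Finset α)
    (f : α → β) :
    #s ^ 2 ≤ #(s.image f) *
      (#s + #((s ×ˢ s).filter fun p => p.1 ≠ p.2 ∧ f p.1 = f p.2)) := by
  have h1 : #s = ∑ b ∈ s.image f, #(s.filter fun a => f a = b) :=
    Finset.card_eq_sum_card_image f s
  have h2 : #((s ×ˢ s).filter fun p => f p.1 = f p.2) =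
      ∑ b ∈ s.image f, #(s.filter fun a => f a = b) ^ 2 := by
    rw [Finset.card_eq_sum_card_fiberwise (f := fun p => f p.1) (t := s.image f)]
    · refine Finset.sum_congr rfl fun b _ => ?_
      rw [sq, ← card_product]
      congr 1
      ext ⟨x, y⟩
      simp only [mem_filter, mem_product]
      constructor
      · rintro ⟨⟨⟨hx, hy⟩, hxy⟩, hb⟩
        exact ⟨⟨hx, hb⟩, hy, hxy ▸ hb⟩
      · rintro ⟨⟨hx, hb⟩, hy, hb'⟩
        exact ⟨⟨⟨hx, hy⟩, hb.trans hb'.symm⟩, hb⟩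
    · intro p hp
      simp only [coe_filter, mem_product, Set.mem_ofPred_eq] at hp
      exact Finset.mem_coe.2 (Finset.mem_image_of_mem _ hp.1.1)
  have h3 : #((s ×ˢ s).filter fun p => f p.1 = f p.2) ≤
      #s + #((s ×ˢ s).filter fun p => p.1 ≠ p.2 ∧ f p.1 = f p.2) := by
    rw [← Finset.diag_card s]
    refine (Finset.card_le_card ?_).trans (Finset.card_union_le _ _)
    rintro ⟨x, y⟩ h
    simp only [mem_filter, mem_product, mem_union, mem_diag] at h ⊢
    tauto
  calc #s ^ 2 = (∑ b ∈ s.image f, #(s.filter fun a => f a = b)) ^ 2 := by rw [← h1]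
    _ ≤ #(s.image f) * ∑ b ∈ s.image f, #(s.filter fun a => f a = b) ^ 2 :=
      sq_sum_le_card_mul_sum_sq
    _ ≤ _ := by rw [← h2]; exact Nat.mul_le_mul_left _ h3

/-- The lower bound on the number of attained moment vectors that the second moment method
gives. -/
lemma choose_mul_pow_le_card_image (P : Finset F) {k : ℕ} (hk : 0 < k) (hP : k ≤ #P) :
    (#P).choose k * (Fintype.card F - 1) ^ (2 * k - 1) ≤
      #((exactWeights P k).image (momentVec (2 * k - 1))) *
        ((Fintype.card F - 1) ^ (k - 1) + (#P).choose k) := by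
  have h1 := sq_card_le_card_image_mul (exactWeights P k) (momentVec (2 * k - 1))
  have h2 := card_collisions_le P hk
  rw [card_exactWeights] at h1
  set C := (#P).choose k
  set m := Fintype.card F - 1
  have hm : 0 < m := Nat.sub_pos_of_lt Fintype.one_lt_card
  have hC : 0 < C := Nat.choose_pos hP
  have h3 := h1.trans (Nat.mul_le_mul_left _ (Nat.add_le_add_left h2 _))
  obtain ⟨k, rfl⟩ : ∃ l, k = l + 1 := ⟨k - 1, by omega⟩
  -- The second moment bound reads `(C m^k)² ≤ |image| (C m^k + C² m)`; cancel `C m`.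
  refine le_of_mul_le_mul_left (a := C * m) ?_ (Nat.mul_pos hC hm)
  have e1 : 2 * (k + 1) - 1 = 2 * k + 1 := by omega
  rw [e1] at h3 ⊢
  rw [Nat.add_sub_cancel]
  calc C * m * (C * m ^ (2 * k + 1)) = (C * m ^ (k + 1)) ^ 2 := by ring
    _ ≤ _ := h3
    _ = _ := by ring

/-- The set of zeroth moments of weights with `k`-point support in `P` and prescribed moments of
order `1, …, 2 * k - 2`. -/
def innerFiber (P : Finset F) (k : ℕ) (u : Fin (2 * k - 2) → F) : Finset F :=
  univ.filter fun y => ∃ f ∈ exactWeights P k, moment f 0 = y ∧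
    ∀ j : Fin (2 * k - 2), moment f (j + 1) = u j

/-- Pigeonhole: the attained vectors of `2k - 1` moments are distributed over `|F| ^ (2k - 2)`
choices of the moments of positive order. -/
lemma exists_large_innerFiber (P : Finset F) {k : ℕ} (hk : 0 < k) (hP : k ≤ #P) :
    ∃ u : Fin (2 * k - 2) → F, (#P).choose k * (Fintype.card F - 1) ^ (2 * k - 1) ≤
      #(innerFiber P k u) * Fintype.card F ^ (2 * k - 2) *
        ((Fintype.card F - 1) ^ (k - 1) + (#P).choose k) := by
  obtain ⟨u, -, hu⟩ := Finset.exists_mem_eq_sup univ univ_nonempty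
    (fun u : Fin (2 * k - 2) → F => #(innerFiber P k u))
  refine ⟨u, (choose_mul_pow_le_card_image P hk hP).trans (Nat.mul_le_mul_right _ ?_)⟩
  have hinj : #((exactWeights P k).image (momentVec (2 * k - 1))) ≤
      #((univ : Finset (Fin (2 * k - 2) → F)).sigma fun u => innerFiber P k u) := by
    refine Finset.card_le_card_of_injOn (fun w => ⟨fun j => w ⟨j + 1, by omega⟩,
      w ⟨0, by omega⟩⟩) ?_ ?_
    · intro w hw
      obtain ⟨f, hf, rfl⟩ := Finset.mem_image.1 (Finset.mem_coe.1 hw)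
      simp only [coe_sigma, Set.mem_sigma_iff, mem_coe, mem_univ, true_and]
      simp only [innerFiber, mem_filter, mem_univ, true_and]
      exact ⟨f, hf, rfl, fun j => rfl⟩
    · intro w _ w' _ h
      simp only [Sigma.mk.injEq, heq_eq_eq] at h
      ext j
      rcases Nat.eq_zero_or_pos (j : ℕ) with hj | hj
      · have : j = ⟨0, by omega⟩ := Fin.ext hj
        rw [this, h.2]
      · have h1 := congrFun h.1 ⟨j - 1, by omega⟩
        have : j = ⟨(j : ℕ) - 1 + 1, by omega⟩ := Fin.ext (by simp; omega)
        rw [this]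
        exact h1
  refine hinj.trans ?_
  rw [Finset.card_sigma]
  refine (Finset.sum_le_card_nsmul _ _ #(innerFiber P k u) fun v _ => ?_).trans ?_
  · rw [← hu]
    exact Finset.le_sup (f := fun u : Fin (2 * k - 2) → F => #(innerFiber P k u)) (mem_univ v)
  · simp [mul_comm]

lemma innerFiber_subset_fiber {P : Finset F} (hP : 0 ∉ P) {k : ℕ} (u : Fin (2 * k - 2) → F) :
    innerFiber P k u ⊆ fiber (2 * k - 2) k u := by
  intro y hy
  simp only [innerFiber, mem_filter, mem_univ, true_and] at hy
  obtain ⟨f, hf, h0, h1⟩ := hy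
  rw [mem_exactWeights] at hf
  refine mem_fiber.2 ⟨f, ⟨?_, hf.2.le⟩, h0, h1⟩
  by_contra h
  exact hP (hf.1 (mem_fsupp.2 h))

/-- One more query, spent on the point `1`, allows one more degree. -/
lemma card_innerFiber_le_maxFiber {P : Finset F} (h0 : 0 ∉ P) (h1 : 1 ∉ P) {k : ℕ}
    (hk : 0 < k) (u : Fin (2 * k - 2) → F) :
    #(innerFiber P k u) ≤ maxFiber F (2 * k - 1) (k + 1) := by
  -- Prefix sums solve the recurrence `hrec` below, started from a vanishing first moment.
  set U : ℕ → F := fun j => ∑ i ∈ Finset.range j, if h : i < 2 * k - 2 then u ⟨i, h⟩ else 0 with hU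
  refine le_trans ?_ (card_fiber_le_maxFiber (fun j : Fin (2 * k - 1) => U j))
  refine Finset.card_le_card_of_injOn (fun y => -y) ?_ (fun a _ b _ h => neg_injective h)
  intro y hy
  simp only [innerFiber, coe_filter, mem_univ, true_and, Set.mem_ofPred_eq] at hy
  obtain ⟨f, hf, hf0, hfu⟩ := hy
  rw [mem_exactWeights] at hf
  have hfz : ∀ x, x ∉ P → f x = 0 := by
    intro x hx
    by_contra h
    exact hx (hf.1 (mem_fsupp.2 h))
  -- Dividing by `x - 1` makes the moments of `f` the successive differences of those of `g₀`; at `x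
  -- = 1` nothing is lost since `f 1 = 0`. A point mass at `1` shifts all moments equally, so it
  -- preserves the differences and can make the first moment `0`. Then the zeroth moment of `g` is
  -- minus that of `f`.
  set g₀ : F → F := fun x => f x / (x - 1) with hg₀
  set g : F → F := g₀ + Pi.single 1 (-moment g₀ 1) with hg
  have hrec : ∀ j, moment g (j + 1) = moment g j + moment f j := by
    intro j
    rw [hg, moment_add, moment_add, moment_single, moment_single]
    have : moment g₀ (j + 1) = moment g₀ j + moment f j := by
      rw [moment, moment, moment, ← Finset.sum_add_distrib]
      refine Finset.sum_congr rfl fun x _ => ?_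
      by_cases hx : x = 1
      · subst hx
        simp [hg₀, hfz 1 h1]
      · have := sub_ne_zero.2 hx
        simp only [hg₀]
        field_simp
        ring
    rw [this]
    ring
  have hg1 : moment g 1 = 0 := by
    rw [hg, moment_add, moment_single]
    ring
  refine Finset.mem_coe.2 (mem_fiber.2 ⟨g, ⟨?_, ?_⟩, ?_, ?_⟩)
  · simp [hg, hg₀, hfz 0 h0]
  · refine (Finset.card_le_card (fsupp_add_subset _ _)).trans
      ((Finset.card_union_le _ _).trans (Nat.add_le_add ?_ ?_))
    · rw [← hf.2]
      refine Finset.card_le_card fun x hx => ?_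
      rw [mem_fsupp] at hx ⊢
      intro h
      simp [hg₀, h] at hx
    · exact (Finset.card_le_card (fsupp_single_subset _ _)).trans (by simp)
  · have := hrec 0
    rw [zero_add, hg1, hf0] at this
    exact eq_neg_of_add_eq_zero_left this.symm
  · rintro ⟨j, hj⟩
    simp only
    induction j with
    | zero => rw [zero_add, hg1]; simp [hU]
    | succ i ih =>
      have hi : i < 2 * k - 2 := by omega
      rw [hrec, ih (by omega), hfu ⟨i, hi⟩]
      simp only [hU]
      rw [Finset.sum_range_succ, dif_pos hi]

end Counting

/-! ### Numerical estimates for the second moment bound -/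

section Numerics

/-- This is `∏ (1 - (ε + i) / m) ≥ 1 - ∑ (ε + i) / m` over `i < k`, with denominators cleared. -/
lemma pow_mul_sub_le_descFactorial (m ε k : ℕ) (hk : k + ε ≤ m) :
    (m : ℝ) ^ k * (m - (k * (k - 1) / 2 + ε * k)) ≤ m * ((m - ε).descFactorial k : ℝ) := by
  induction k with
  | zero => simp
  | succ k ih =>
    have ih := ih (by omega)
    rw [Nat.descFactorial_succ, Nat.cast_mul, Nat.cast_sub (by omega), Nat.cast_sub (by omega)]
    have h1 : (0 : ℝ) ≤ m - ε - k := by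
      have : ((k + 1 + ε : ℕ) : ℝ) ≤ m := by exact_mod_cast hk
      push_cast at this
      linarith
    have h2 := mul_le_mul_of_nonneg_left ih h1
    have h3 : (0 : ℝ) ≤ k * (k - 1) / 2 + ε * k := by
      rcases Nat.eq_zero_or_pos k with h | h
      · simp [h]
      · have : (1 : ℝ) ≤ k := by exact_mod_cast h
        have : (0 : ℝ) ≤ k - 1 := by linarith
        positivity
    have h4 : (0 : ℝ) ≤ (m : ℝ) ^ k * ((k * (k - 1) / 2 + ε * k) * (ε + k)) := by positivity
    push_cast
    calc (m : ℝ) ^ (k + 1) * (m - ((k + 1) * (k + 1 - 1) / 2 + ε * (k + 1)))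
        = (m - ε - k) * ((m : ℝ) ^ k * (m - (k * (k - 1) / 2 + ε * k))) -
          (m : ℝ) ^ k * ((k * (k - 1) / 2 + ε * k) * (ε + k)) := by ring
      _ ≤ _ := by linarith

lemma triangle_add_one_le_factorial (k : ℕ) : (k * (k - 1) / 2 + 1 : ℝ) ≤ k ! ∨ k = 0 := by
  induction k with
  | zero => simp
  | succ k ih =>
    left
    rcases ih with ih | rfl
    · rcases Nat.lt_or_ge k 2 with hk | hk
      · interval_cases k <;> norm_num
      · rw [Nat.factorial_succ]
        push_cast
        have hk' : (2 : ℝ) ≤ k := by exact_mod_cast hk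
        nlinarith [mul_le_mul_of_nonneg_left ih (by positivity : (0 : ℝ) ≤ k + 1),
          mul_nonneg (sub_nonneg.2 hk') (sub_nonneg.2 hk')]
    · norm_num

lemma triangle_le_factorial {k : ℕ} (hk : 3 ≤ k) : (k * (k + 1) / 2 : ℝ) ≤ k ! := by
  induction k, hk using Nat.le_induction with
  | base => norm_num [Nat.factorial]
  | succ k hk ih =>
    rw [Nat.factorial_succ]
    push_cast
    have hk' : (3 : ℝ) ≤ k := by exact_mod_cast hk
    nlinarith [mul_le_mul_of_nonneg_left ih (by positivity : (0 : ℝ) ≤ k + 1)]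

/-- With `C = (m - ε).choose k`, this amounts to `C / (m^(k-1) + C) ≥ 1 - (k! + ε) / (m + 1)`:
collisions cost at most `k! + ε`. -/
lemma factorial_mul_pow_le {m ε k : ℕ} (hk : 0 < k) (hε : ε ≤ 1) (hm : k ! + 2 * k - 1 + ε ≤ m) :
    (k ! : ℝ) * ((m : ℝ) ^ (k - 1) * (m + 1 - (k ! : ℝ) - ε)) ≤
      (k ! + ε) * ((m - ε).descFactorial k : ℝ) := by
  have hkm : k + ε ≤ m := by
    have := Nat.self_le_factorial k
    omega
  have h1 := pow_mul_sub_le_descFactorial m ε k hkm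
  have hm0 : (0 : ℝ) < m := by
    have : 0 < m := by omega
    exact_mod_cast this
  have h2 : (m : ℝ) ^ (k - 1) * (m - (k * (k - 1) / 2 + ε * k)) ≤
      ((m - ε).descFactorial k : ℝ) := by
    refine le_of_mul_le_mul_left ?_ hm0
    rw [← mul_assoc, ← pow_succ', Nat.sub_add_cancel hk]
    exact h1
  have h3 : (0 : ℝ) ≤ (k ! + ε) := by positivity
  refine le_trans ?_ (mul_le_mul_of_nonneg_left h2 h3)
  rw [← mul_assoc, mul_comm (k ! : ℝ), ← mul_assoc, mul_comm ((k ! : ℝ) + ε), mul_assoc, mul_assoc]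
  refine mul_le_mul_of_nonneg_left ?_ (by positivity)
  interval_cases ε
  · rcases triangle_add_one_le_factorial k with h | h
    · push_cast
      have : (0 : ℝ) ≤ k ! := by positivity
      nlinarith [mul_le_mul_of_nonneg_left h this]
    · omega
  · push_cast
    rcases Nat.lt_or_ge k 3 with hk3 | hk3
    -- `triangle_le_factorial` fails at `k = 2`, where the size of `m` compensates.
    · interval_cases k
      · norm_num
        have : (1 : ℝ) ≤ m := by exact_mod_cast (by omega : 1 ≤ m)
        linarith
      · have : (6 : ℝ) ≤ m := by
          have : 6 ≤ m := by simpa [Nat.factorial] using hm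
          exact_mod_cast this
        norm_num [Nat.factorial]
        linarith
    · have h := triangle_le_factorial hk3
      have h5 : (k ! : ℝ) ≤ m := by exact_mod_cast (by omega : k ! ≤ m)
      have : (0 : ℝ) ≤ (k ! : ℝ) + 1 := by positivity
      nlinarith [mul_le_mul_of_nonneg_left h this]

/-- Here `m = |F| - 1`, `ε` counts the nonzero points left out, and `M` is a fiber size. Collisions
cost `k! + ε`; the factor `(m / (m + 1)) ^ (2k - 1)` costs `2k - 1` by Bernoulli (`h4`). The two
losses add up because `(1 - s)(1 - t) ≥ 1 - s - t` (`h6`). -/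
lemma sub_factorial_le_of_choose_mul_pow_le {m ε k M : ℕ} (hk : 0 < k) (hε : ε ≤ 1)
    (hm : k ! + 2 * k - 1 + ε ≤ m)
    (h : (m - ε).choose k * m ^ (2 * k - 1) ≤
      M * (m + 1) ^ (2 * k - 2) * (m ^ (k - 1) + (m - ε).choose k)) :
    m + 1 ≤ M + (k ! + 2 * k - 1 + ε) := by
  have hm0 : (0 : ℝ) < m := by
    have : 0 < m := by omega
    exact_mod_cast this
  set C := (m - ε).choose k with hC
  have hA : ((m - ε).descFactorial k : ℝ) = k ! * C := by
    rw [Nat.descFactorial_eq_factorial_mul_choose]; push_cast; rfl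
  have hfac : (0 : ℝ) < k ! := by exact_mod_cast Nat.factorial_pos k
  have h1 : (m : ℝ) ^ (k - 1) * (m + 1 - (k ! : ℝ) - ε) ≤ (k ! + ε) * C := by
    have := factorial_mul_pow_le hk hε hm
    rw [hA] at this
    refine le_of_mul_le_mul_left (this.trans_eq ?_) hfac
    ring
  have h2 : ((m : ℝ) + 1 - (k ! : ℝ) - ε) * ((m : ℝ) ^ (k - 1) + C) ≤ C * (m + 1) := by linarith
  have hD : (0 : ℝ) < (m : ℝ) ^ (k - 1) + C := by positivity
  have h' : (C : ℝ) * (m : ℝ) ^ (2 * k - 1) ≤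
      M * ((m : ℝ) + 1) ^ (2 * k - 2) * ((m : ℝ) ^ (k - 1) + C) := by exact_mod_cast h
  obtain ⟨n, hn⟩ : ∃ n, 2 * k - 1 = n + 1 := ⟨2 * k - 2, by omega⟩
  have hn' : 2 * k - 2 = n := by omega
  rw [hn, hn'] at h'
  have h3 : ((m : ℝ) + 1 - (k ! : ℝ) - ε) * (m : ℝ) ^ (n + 1) ≤ M * ((m : ℝ) + 1) ^ (n + 1) := by
    refine le_of_mul_le_mul_left ?_ hD
    calc ((m : ℝ) ^ (k - 1) + C) * (((m : ℝ) + 1 - (k ! : ℝ) - ε) * (m : ℝ) ^ (n + 1))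
        = (((m : ℝ) + 1 - (k ! : ℝ) - ε) * ((m : ℝ) ^ (k - 1) + C)) * (m : ℝ) ^ (n + 1) := by ring
      _ ≤ (C * (m + 1)) * (m : ℝ) ^ (n + 1) := mul_le_mul_of_nonneg_right h2 (by positivity)
      _ = (C * (m : ℝ) ^ (n + 1)) * (m + 1) := by ring
      _ ≤ (M * ((m : ℝ) + 1) ^ n * ((m : ℝ) ^ (k - 1) + C)) * (m + 1) :=
        mul_le_mul_of_nonneg_right h' (by positivity)
      _ = _ := by ring
  have hF : (0 : ℝ) < (m : ℝ) + 1 := by positivity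
  have h4 : ((m : ℝ) + 1) ^ (n + 1) * (m + 1 - (n + 1 : ℕ)) ≤ (m : ℝ) ^ (n + 1) * (m + 1) := by
    have hb := one_add_mul_le_pow (a := -1 / ((m : ℝ) + 1)) (by
      rw [le_div_iff₀ hF]; linarith) (n + 1)
    have e1 : 1 + -1 / ((m : ℝ) + 1) = m / (m + 1) := by field_simp; ring
    rw [e1, div_pow, le_div_iff₀ (by positivity)] at hb
    have := mul_le_mul_of_nonneg_right hb hF.le
    refine le_trans (le_of_eq ?_) this
    field_simp
    ring
  have hnn : (0 : ℝ) ≤ (m : ℝ) + 1 - (k ! : ℝ) - ε := by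
    have : ((k ! + ε : ℕ) : ℝ) ≤ (m + 1 : ℕ) := by
      exact_mod_cast (by omega : k ! + ε ≤ m + 1)
    push_cast at this
    linarith
  have h5 : ((m : ℝ) + 1 - (k ! : ℝ) - ε) * (m + 1 - (n + 1 : ℕ)) ≤ M * (m + 1) := by
    have hp : (0 : ℝ) < ((m : ℝ) + 1) ^ (n + 1) := by positivity
    refine le_of_mul_le_mul_left ?_ hp
    calc ((m : ℝ) + 1) ^ (n + 1) * (((m : ℝ) + 1 - (k ! : ℝ) - ε) * (m + 1 - (n + 1 : ℕ)))
        = ((m : ℝ) + 1 - (k ! : ℝ) - ε) * (((m : ℝ) + 1) ^ (n + 1) * (m + 1 - (n + 1 : ℕ))) := by ring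
      _ ≤ ((m : ℝ) + 1 - (k ! : ℝ) - ε) * ((m : ℝ) ^ (n + 1) * (m + 1)) :=
        mul_le_mul_of_nonneg_left h4 hnn
      _ = (((m : ℝ) + 1 - (k ! : ℝ) - ε) * (m : ℝ) ^ (n + 1)) * (m + 1) := by ring
      _ ≤ (M * ((m : ℝ) + 1) ^ (n + 1)) * (m + 1) := mul_le_mul_of_nonneg_right h3 hF.le
      _ = _ := by ring
  have h6 : (m : ℝ) + 1 - (k ! : ℝ) - ε - (n + 1 : ℕ) ≤ M := by
    refine le_of_mul_le_mul_right (le_trans ?_ h5) hF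
    have : (0 : ℝ) ≤ (k ! + ε) * (n + 1 : ℕ) := by positivity
    nlinarith
  have h7 : (m : ℝ) + 1 ≤ M + (k ! + ε + (n + 1 : ℕ)) := by linarith
  have h8 : m + 1 ≤ M + (k ! + ε + (n + 1)) := by exact_mod_cast h7
  omega

end Numerics

/-! ### A large fiber when `2q ≥ d + 2` -/

section LargeFiber

variable {F : Type*} [Field F] [Fintype F] [DecidableEq F]

lemma card_le_maxFiber_add {d q : ℕ} (h : d + 2 ≤ 2 * q) :
    Fintype.card F ≤ maxFiber F d q + ((d / 2 + 1)! + d + 1) := by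
  set k := d / 2 + 1 with hk
  -- The negation makes the field large enough for the numerical estimates.
  by_contra! hlt
  have hfac := Nat.self_le_factorial k
  obtain ⟨m, hm⟩ : ∃ m, Fintype.card F = m + 1 :=
    ⟨Fintype.card F - 1, (Nat.sub_add_cancel Fintype.card_pos).symm⟩
  have hm' : Fintype.card F - 1 = m := by omega
  rcases Nat.even_or_odd' d with ⟨c, hc | hc⟩
  · have hck : k = c + 1 := by omega
    set P : Finset F := univ.erase 0
    have hP : #P = m - 0 := by rw [Finset.card_erase_of_mem (mem_univ _), Finset.card_univ]; omega
    obtain ⟨u, hu⟩ := exists_large_innerFiber P (k := k) (by omega) (by omega)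
    have h1 := (Finset.card_le_card (innerFiber_subset_fiber (P := P) (by simp [P]) u)).trans
      ((card_fiber_le_maxFiber u).trans (maxFiber_mono (by omega : k ≤ q)))
    rw [hP, hm, Nat.add_sub_cancel] at hu
    have h2 := sub_factorial_le_of_choose_mul_pow_le (by omega) (by omega) (by omega) hu
    have hd : 2 * k - 2 = d := by omega
    rw [hd] at h1
    omega
  · have hck : k = c + 1 := by omega
    -- The point `1` is reserved for the extra query, hence `ε = 1`; now `2k - 1 + ε` is again `d +
    -- 1`.
    set P : Finset F := (univ.erase 0).erase 1
    have hP : #P = m - 1 := by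
      rw [Finset.card_erase_of_mem (by simp), Finset.card_erase_of_mem (mem_univ _),
        Finset.card_univ]
      omega
    obtain ⟨u, hu⟩ := exists_large_innerFiber P (k := k) (by omega) (by omega)
    have h1 := (card_innerFiber_le_maxFiber (P := P) (by simp [P]) (by simp [P])
      (by omega) u).trans (maxFiber_mono (by omega : k + 1 ≤ q))
    rw [hP, hm, Nat.add_sub_cancel] at hu
    have h2 := sub_factorial_le_of_choose_mul_pow_le (by omega) (by omega) (by omega) hu
    have hd : 2 * k - 1 = d := by omega
    rw [hd] at h1
    omega

end LargeFiber

/-! ### Orthogonality of characters -/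

section Parseval

lemma sum_norm_sq_of_orthogonal {A B : Type*} [Fintype A] [Fintype B] [DecidableEq A]
    (χ : B → A → ℂ) (N : ℝ)
    (h : ∀ a a', ∑ b, χ b a * starRingEnd ℂ (χ b a') = if a = a' then (N : ℂ) else 0)
    (f : A → ℂ) : ∑ b, ‖∑ a, χ b a * f a‖ ^ 2 = N * ∑ a, ‖f a‖ ^ 2 := by
  have key : ((∑ b, ‖∑ a, χ b a * f a‖ ^ 2 : ℝ) : ℂ) = ((N * ∑ a, ‖f a‖ ^ 2 : ℝ) : ℂ) := by
    push_cast
    simp_rw [← Complex.mul_conj', map_sum, Finset.sum_mul_sum, map_mul]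
    rw [Finset.sum_comm, Finset.mul_sum]
    refine Finset.sum_congr rfl fun a _ => ?_
    rw [Finset.sum_comm]
    have : ∀ a', ∑ b, χ b a * f a * (starRingEnd ℂ (χ b a') * starRingEnd ℂ (f a')) =
        if a = a' then (N : ℂ) * (f a * starRingEnd ℂ (f a)) else 0 := by
      intro a'
      calc _ = (∑ b, χ b a * starRingEnd ℂ (χ b a')) * (f a * starRingEnd ℂ (f a')) := by
            rw [Finset.sum_mul]; exact Finset.sum_congr rfl fun b _ => by ring
        _ = _ := by
            rw [h]
            split_ifs with haa
            · rw [haa]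
            · rw [zero_mul]
    rw [Finset.sum_congr rfl fun a' _ => this a', Finset.sum_ite_eq, if_pos (mem_univ a)]
  exact_mod_cast key

variable {F : Type*} [Field F] [Fintype F] [DecidableEq F]

lemma exists_primitive_addChar (F : Type*) [Field F] [Fintype F] :
    ∃ e : AddChar F ℂ, e.IsPrimitive := by
  obtain ⟨ψ, hψ⟩ := (AddChar.exists_apply_ne_zero (a := (1 : F))).2 one_ne_zero
  exact ⟨ψ, AddChar.IsPrimitive.of_ne_one (AddChar.ne_one_iff.2 ⟨1, hψ⟩)⟩

lemma exists_eq_mulShift {F : Type*} [Field F] [Fintype F] {e : AddChar F ℂ} (he : e.IsPrimitive) (ξ : AddChar F ℂ) :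
    ∃ c, e.mulShift c = ξ :=
  ((Fintype.bijective_iff_injective_and_card _).2
    ⟨AddChar.to_mulShift_inj_of_isPrimitive he, AddChar.card_eq.symm⟩).2 ξ

lemma sum_addChar_mul_conj {e : AddChar F ℂ} (he : e.IsPrimitive) (y y' : F) :
    ∑ o, e (-(o * y)) * starRingEnd ℂ (e (-(o * y'))) =
      if y = y' then ((Fintype.card F : ℝ) : ℂ) else 0 := by
  have h := AddChar.sum_mulShift (y' - y) he
  simp_rw [sub_eq_zero] at h
  rw [Finset.sum_congr rfl (g := fun o => e (o * (y' - y)))]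
  · rw [h]
    by_cases hy : y = y'
    · simp [hy]
    · simp [hy, Ne.symm hy]
  · intro o _
    rw [← AddChar.map_neg_eq_conj, ← AddChar.map_add_eq_mul]
    congr 1
    ring

lemma sum_addChar_dotProduct_mul_conj {e : AddChar F ℂ} (he : e.IsPrimitive) {n : ℕ}
    (u u' : Fin n → F) :
    ∑ h : Fin n → F, e (u ⬝ᵥ h) * starRingEnd ℂ (e (u' ⬝ᵥ h)) =
      if u = u' then (((Fintype.card F : ℝ) ^ n : ℝ) : ℂ) else 0 := by
  classical
  set ψ : AddChar (Fin n → F) ℂ := e.compAddMonoidHom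
    (AddMonoidHom.mk' (fun h => (u - u') ⬝ᵥ h) fun a b => dotProduct_add _ a b) with hψ
  have h1 : ∀ h, e (u ⬝ᵥ h) * starRingEnd ℂ (e (u' ⬝ᵥ h)) = ψ h := by
    intro h
    rw [← AddChar.map_neg_eq_conj, ← AddChar.map_add_eq_mul, hψ]
    simp [sub_eq_add_neg]
  rw [Finset.sum_congr rfl fun h _ => h1 h, AddChar.sum_eq_ite]
  have h2 : ψ = 0 ↔ u = u' := by
    constructor
    · intro h0
      by_contra hne
      obtain ⟨i, hi⟩ := Function.ne_iff.1 (sub_ne_zero.2 hne)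
      refine he hi (AddChar.ext _ _ fun x => ?_)
      have := DFunLike.congr_fun h0 (Pi.single i x)
      simpa [hψ, sub_mul] using this
    · rintro rfl
      ext h
      simp [hψ]
  simp only [h2]
  simp

end Parseval

/-! ### No algorithm beats the largest fiber -/

section UpperBound

variable {F : Type*} [Field F] [Fintype F] [DecidableEq F]

lemma eval_polyOfCoeffs {F : Type*} [Field F] {d : ℕ} (a : Fin (d + 1) → F) (x : F) :
    (polyOfCoeffs a).eval x = (fun i : Fin (d + 1) => x ^ (i : ℕ)) ⬝ᵥ a := by
  simp [polyOfCoeffs, Polynomial.eval_finsetSum, dotProduct, mul_comm]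

lemma eval_zero_polyOfCoeffs {F : Type*} [Field F] {d : ℕ} (a : Fin (d + 1) → F) : (polyOfCoeffs a).eval 0 = a 0 := by
  rw [eval_polyOfCoeffs, dotProduct, Finset.sum_eq_single 0]
  · simp
  · intro i _ hi
    have : (i : ℕ) ≠ 0 := fun h => hi (Fin.ext h)
    simp [this]
  · simp

/-- The vectors of moments that `q` queries can reach. -/
def Reachable {n : ℕ} (q : ℕ) (w : Fin n → F) : Prop :=
  ∃ f : F → F, Sparse q f ∧ ∀ j : Fin n, moment f j = w j

lemma Reachable.add {n q : ℕ} {w : Fin n → F} (hw : Reachable q w) {x : F} (hx : x ≠ 0) (c : F) :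
    Reachable (q + 1) (w + c • fun j : Fin n => x ^ (j : ℕ)) := by
  obtain ⟨f, ⟨hf0, hf⟩, hm⟩ := hw
  refine ⟨f + Pi.single x c, ⟨?_, ?_⟩, fun j => ?_⟩
  · simp [hf0, hx.symm]
  · exact (Finset.card_le_card (fsupp_add_subset _ _)).trans ((Finset.card_union_le _ _).trans
      (Nat.add_le_add hf ((Finset.card_le_card (fsupp_single_subset _ _)).trans (by simp))))
  · rw [moment_add, moment_single, hm]
    simp

/-- The state after `q` queries is a combination of characters of the coefficient vector, the
characters being reachable by `q` queries. -/
lemma exists_amplitudes {e : AddChar F ℂ} (he : e.IsPrimitive) (d : ℕ)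
    (Q : QAlgorithm {x : F // x ≠ 0} F F) (q : ℕ) :
    ∃ Φ : (Fin (d + 1) → F) → QState {x : F // x ≠ 0} F Q.workDim,
      (∀ w, Φ w ≠ 0 → Reachable q w) ∧ ∑ w, ‖Φ w‖ ^ 2 = 1 ∧
      ∀ a : Fin (d + 1) → F, Q.run (fun x => (polyOfCoeffs a).eval (x : F)) q =
        ∑ w, e (w ⬝ᵥ a) • Φ w := by
  induction q with
  | zero =>
    refine ⟨Pi.single 0 Q.init, ?_, ?_, ?_⟩
    · intro w hw
      have : w = 0 := by
        by_contra h
        exact hw (Pi.single_eq_of_ne h _)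
      subst this
      exact ⟨0, ⟨rfl, by simp [fsupp]⟩, fun j => by simp [moment]⟩
    · rw [Finset.sum_eq_single 0]
      · simp [Q.norm_init]
      · intro w _ hw
        simp [hw]
      · simp
    · intro a
      rw [Finset.sum_eq_single 0]
      · simp [QAlgorithm.run]
      · intro w _ hw
        simp [hw]
      · simp
  | succ q ih =>
    obtain ⟨Φ, hreach, hnorm, hrun⟩ := ih
    choose c hc using exists_eq_mulShift he
    -- A query multiplies the component at `b` by `e (s b ⬝ᵥ a)`, that is, it translates the
    -- character index `w` by `s b`.
    set s : QBasis {x : F // x ≠ 0} F Q.workDim → (Fin (d + 1) → F) :=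
      fun b => c b.2.1 • fun j : Fin (d + 1) => (b.1 : F) ^ (j : ℕ) with hs
    set Φ' : (Fin (d + 1) → F) → QState {x : F // x ≠ 0} F Q.workDim :=
      fun w => WithLp.toLp 2 fun b => Φ (w - s b) b with hΦ'
    refine ⟨fun w => Q.step q (Φ' w), ?_, ?_, ?_⟩
    · intro w hw
      have hw' : Φ' w ≠ 0 := fun h => hw (by simp only [h, map_zero])
      obtain ⟨b, hb⟩ : ∃ b, Φ (w - s b) b ≠ 0 := by
        by_contra! h
        exact hw' (by ext b; exact h b)
      have hr := (hreach (w - s b) (fun h => hb (by rw [h]; rfl))).add b.1.2 (c b.2.1)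
      rwa [show w - s b + (c b.2.1 • fun j : Fin (d + 1) => (b.1 : F) ^ (j : ℕ)) = w from
        sub_add_cancel w (s b)] at hr
    · simp_rw [LinearIsometryEquiv.norm_map]
      rw [← hnorm]
      simp_rw [EuclideanSpace.norm_sq_eq]
      rw [Finset.sum_comm, Finset.sum_comm (s := univ) (t := univ)
        (f := fun w b => ‖Φ w b‖ ^ 2)]
      refine Finset.sum_congr rfl fun b _ => ?_
      exact Fintype.sum_equiv (Equiv.subRight (s b)) _ _ fun w => rfl
    · intro a
      simp only [QAlgorithm.run]
      rw [hrun]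
      have : phaseQuery (fun x : {x : F // x ≠ 0} => (polyOfCoeffs a).eval (x : F))
          (∑ w, e (w ⬝ᵥ a) • Φ w) = ∑ w, e (w ⬝ᵥ a) • Φ' w := by
        ext b
        simp only [phaseQuery, WithLp.ofLp_sum, WithLp.ofLp_smul, Finset.sum_apply,
          Pi.smul_apply, smul_eq_mul, hΦ']
        rw [Finset.mul_sum]
        refine Fintype.sum_equiv (Equiv.addRight (s b)) _ _ fun w => ?_
        rw [Equiv.coe_addRight, add_sub_cancel_right, add_dotProduct, AddChar.map_add_eq_mul]
        have h1 : b.2.1 ((polyOfCoeffs a).eval (b.1 : F)) = e (s b ⬝ᵥ a) := by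
          conv_lhs => rw [← hc b.2.1]
          rw [AddChar.mulShift_apply, eval_polyOfCoeffs, hs, smul_dotProduct, smul_eq_mul]
        rw [h1]
        ring
      rw [this, map_sum]
      simp_rw [map_smul]

lemma sum_fin_succ_pi {F M : Type*} [Fintype F] [AddCommMonoid M] {d : ℕ} (g : (Fin (d + 1) → F) → M) :
    ∑ a, g a = ∑ o, ∑ h : Fin d → F, g (Fin.cons o h) := by
  rw [← Fintype.sum_prod_type' (f := fun o h => g (Fin.cons o h))]
  exact (Fintype.sum_equiv (Fin.consEquiv fun _ => F) _ _ fun p => rfl).symm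

lemma cons_dotProduct_fin_cons {F : Type*} [Field F] {d : ℕ} (y o : F) (u h : Fin d → F) :
    (Fin.cons y u : Fin (d + 1) → F) ⬝ᵥ (Fin.cons o h) = y * o + u ⬝ᵥ h := by
  simp [dotProduct, Fin.sum_univ_succ]

lemma mem_fiber_of_reachable {d q : ℕ} {y : F} {u : Fin d → F}
    (h : Reachable q (Fin.cons y u : Fin (d + 1) → F)) : y ∈ fiber d q u := by
  obtain ⟨f, hf, hm⟩ := h
  exact mem_fiber.2 ⟨f, hf, by simpa using hm 0, fun j => by simpa using hm j.succ⟩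

/-- An outcome counts only for the polynomials whose constant term it announces. Parseval over the
other `d` coefficients separates the `u`, and Cauchy–Schwarz over each fiber costs a factor
`maxFiber`. -/
theorem extrapolationProb_le (d q : ℕ) (Q : QAlgorithm {x : F // x ≠ 0} F F) :
    extrapolationProb d q Q ≤ (maxFiber F d q : ℝ) / Fintype.card F := by
  obtain ⟨e, he⟩ := exists_primitive_addChar F
  obtain ⟨Φ, hreach, hnorm, hrun⟩ := exists_amplitudes he d Q q
  have hF : (0 : ℝ) < Fintype.card F := by exact_mod_cast Fintype.card_pos
  set N : ℝ := (Fintype.card F : ℝ) with hN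
  set M : ℝ := (maxFiber F d q : ℝ) with hM
  -- the contribution of a single measurement outcome
  have key : ∀ b : QBasis {x : F // x ≠ 0} F Q.workDim,
      (∑ a : Fin (d + 1) → F, if Q.decode b = a 0 then
        ‖Q.run (fun x => (polyOfCoeffs a).eval (x : F)) q b‖ ^ 2 else 0) ≤
      N ^ d * M * ∑ w, ‖Φ w b‖ ^ 2 := by
    intro b
    rw [sum_fin_succ_pi, Finset.sum_eq_single (Q.decode b)]
    rotate_left
    · intro o _ ho
      refine Finset.sum_eq_zero fun h _ => ?_
      rw [Fin.cons_zero, if_neg (Ne.symm ho)]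
    · simp
    simp only [Fin.cons_zero, if_true]
    set o := Q.decode b
    set G : (Fin d → F) → ℂ := fun u => ∑ y, e (y * o) * Φ (Fin.cons y u) b with hG
    have h1 : ∀ h : Fin d → F,
        Q.run (fun x => (polyOfCoeffs (Fin.cons o h : Fin (d + 1) → F)).eval (x : F)) q b =
          ∑ u, e (u ⬝ᵥ h) * G u := by
      intro h
      rw [hrun, WithLp.ofLp_sum, Finset.sum_apply, sum_fin_succ_pi, Finset.sum_comm]
      refine Finset.sum_congr rfl fun u _ => ?_
      rw [hG, Finset.mul_sum]
      refine Finset.sum_congr rfl fun y _ => ?_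
      rw [cons_dotProduct_fin_cons, AddChar.map_add_eq_mul, WithLp.ofLp_smul, Pi.smul_apply,
        smul_eq_mul]
      ring
    simp_rw [h1]
    rw [sum_norm_sq_of_orthogonal (fun h u => e (u ⬝ᵥ h)) (N ^ d)
      (fun u u' => sum_addChar_dotProduct_mul_conj he u u'), mul_assoc]
    refine mul_le_mul_of_nonneg_left ?_ (by positivity)
    rw [sum_fin_succ_pi, Finset.sum_comm, Finset.mul_sum]
    refine Finset.sum_le_sum fun u _ => ?_
    have h2 : G u = ∑ y ∈ fiber d q u, e (y * o) * Φ (Fin.cons y u) b := by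
      rw [hG]
      symm
      refine Finset.sum_subset (Finset.subset_univ _) fun y _ hy => ?_
      have : Φ (Fin.cons y u) = 0 := by
        by_contra h
        exact hy (mem_fiber_of_reachable (hreach _ h))
      rw [this]
      simp
    have h3 : ‖G u‖ ≤ ∑ y ∈ fiber d q u, ‖Φ (Fin.cons y u) b‖ := by
      rw [h2]
      refine (norm_sum_le _ _).trans_eq (Finset.sum_congr rfl fun y _ => ?_)
      rw [norm_mul, AddChar.norm_apply, one_mul]
    calc ‖G u‖ ^ 2 ≤ (∑ y ∈ fiber d q u, ‖Φ (Fin.cons y u) b‖) ^ 2 :=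
          pow_le_pow_left₀ (norm_nonneg _) h3 2
      _ ≤ #(fiber d q u) * ∑ y ∈ fiber d q u, ‖Φ (Fin.cons y u) b‖ ^ 2 :=
          sq_sum_le_card_mul_sum_sq
      _ ≤ M * ∑ y, ‖Φ (Fin.cons y u) b‖ ^ 2 := by
          refine mul_le_mul ?_ ?_ (by positivity) (by positivity)
          · exact Nat.cast_le.2 (card_fiber_le_maxFiber u)
          · exact Finset.sum_le_sum_of_subset_of_nonneg (Finset.subset_univ _)
              fun _ _ _ => by positivity
  rw [extrapolationProb, Fintype.card_fun, Fintype.card_fin, Nat.cast_pow, div_le_div_iff₀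
    (by positivity) hF]
  have hsum : ∑ a : Fin (d + 1) → F, Q.outputProb q (fun x => (polyOfCoeffs a).eval (x : F))
      ((polyOfCoeffs a).eval 0) ≤ N ^ d * M := by
    simp only [QAlgorithm.outputProb, eval_zero_polyOfCoeffs]
    rw [Finset.sum_comm]
    refine (Finset.sum_le_sum fun b _ => key b).trans_eq ?_
    rw [← Finset.mul_sum, Finset.sum_comm]
    have : ∑ w, ∑ b, ‖Φ w b‖ ^ 2 = 1 := by
      rw [← hnorm]
      exact Finset.sum_congr rfl fun w _ => (EuclideanSpace.norm_sq_eq _).symm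
    rw [this, mul_one]
  calc _ ≤ N ^ d * M * N := mul_le_mul_of_nonneg_right hsum hF.le
    _ = M * N ^ (d + 1) := by ring

end UpperBound

/-! ### Algorithms following query paths in superposition -/

section PathAlgorithm

variable {X F : Type*} [Fintype X] [Field F] [Fintype F]

/-- The enumeration of a finite field by which the workspace register is labelled. -/
noncomputable def label (F : Type*) [Fintype F] : Fin (Fintype.card F) ≃ F :=
  (Fintype.equivFin F).symm

/-- The superposition `∑ y, θ y • |p y, y⟩`. -/
noncomputable def pathState (p : F → X × AddChar F ℂ) (θ : F → ℂ) :
    QState X F (Fintype.card F) :=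
  open Classical in
  WithLp.toLp 2 fun b =>
    if (b.1, b.2.1) = p (label F b.2.2) then θ (label F b.2.2) else 0

lemma sum_qbasis {M : Type*} [AddCommMonoid M] (g : QBasis X F (Fintype.card F) → M) :
    ∑ b, g b = ∑ r : X × AddChar F ℂ, ∑ y, g (r.1, r.2, (label F).symm y) := by
  rw [Fintype.sum_prod_type, Fintype.sum_prod_type]
  refine Finset.sum_congr rfl fun x _ => ?_
  rw [Fintype.sum_prod_type]
  refine Finset.sum_congr rfl fun ξ _ => ?_
  exact Fintype.sum_equiv (label F) _ _ fun z => by simp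

lemma norm_pathState_sq (p : F → X × AddChar F ℂ) (θ : F → ℂ) :
    ‖pathState p θ‖ ^ 2 = ∑ y, ‖θ y‖ ^ 2 := by
  classical
  rw [EuclideanSpace.norm_sq_eq, sum_qbasis, Finset.sum_comm]
  refine Finset.sum_congr rfl fun y _ => ?_
  rw [Finset.sum_eq_single (p y)]
  · simp [pathState]
  · intro r _ hr
    simp [pathState, hr]
  · simp

lemma phaseQuery_pathState {X F : Type*} [Field F] [Fintype F] (A : X → F) (p : F → X × AddChar F ℂ) (θ : F → ℂ) :
    phaseQuery A (pathState p θ) = pathState p fun y => (p y).2 (A (p y).1) * θ y := by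
  ext b
  simp only [phaseQuery, pathState]
  split_ifs with h
  · rw [← h]
  · rw [mul_zero]

/-- The map on the basis that exchanges `|p y, y⟩` and `|p' y, y⟩` for each `y`. -/
noncomputable def pathSwap (p p' : F → X × AddChar F ℂ) (b : QBasis X F (Fintype.card F)) :
    QBasis X F (Fintype.card F) :=
  open Classical in
  let r := Equiv.swap (p (label F b.2.2)) (p' (label F b.2.2)) (b.1, b.2.1)
  (r.1, r.2, b.2.2)

lemma pathSwap_pathSwap {X F : Type*} [Field F] [Fintype F]
    (p p' : F → X × AddChar F ℂ) (b : QBasis X F (Fintype.card F)) :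
    pathSwap p p' (pathSwap p p' b) = b := by
  simp [pathSwap]

/-- The permutation of the basis that exchanges `|p y, y⟩` and `|p' y, y⟩` for each `y`. -/
noncomputable def pathPerm (p p' : F → X × AddChar F ℂ) :
    Equiv.Perm (QBasis X F (Fintype.card F)) where
  toFun := pathSwap p p'
  invFun := pathSwap p p'
  left_inv := pathSwap_pathSwap p p'
  right_inv := pathSwap_pathSwap p p'

/-- The workspace keeps `y`, so a permutation controlled by it moves every branch to its next query,
even where the paths coincide. -/
lemma pathPerm_pathState (p p' : F → X × AddChar F ℂ) (θ : F → ℂ) :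
    LinearIsometryEquiv.piLpCongrLeft 2 ℂ ℂ (pathPerm p p') (pathState p θ) = pathState p' θ := by
  classical
  ext b
  have h : LinearIsometryEquiv.piLpCongrLeft 2 ℂ ℂ (pathPerm p p') (pathState p θ) b =
      pathState p θ (pathSwap p p' b) := rfl
  rw [h]
  simp only [pathState, pathSwap, Prod.mk.eta, Equiv.swap_apply_eq_iff, Equiv.swap_apply_left]

/-- The quantum Fourier transform on the workspace register, as a function. -/
noncomputable def fourierFun (e : AddChar F ℂ) (ψ : QState X F (Fintype.card F)) :
    QState X F (Fintype.card F) :=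
  WithLp.toLp 2 fun b => ∑ y, e (-(label F b.2.2 * y)) *
    (ψ (b.1, b.2.1, (label F).symm y) / (Real.sqrt (Fintype.card F) : ℂ))

variable [DecidableEq F]

lemma norm_fourierFun {e : AddChar F ℂ} (he : e.IsPrimitive)
    (ψ : QState X F (Fintype.card F)) : ‖fourierFun e ψ‖ = ‖ψ‖ := by
  have hF : (0 : ℝ) < Fintype.card F := by exact_mod_cast Fintype.card_pos
  rw [← sq_eq_sq₀ (norm_nonneg _) (norm_nonneg _), EuclideanSpace.norm_sq_eq,
    EuclideanSpace.norm_sq_eq, sum_qbasis, sum_qbasis]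
  refine Finset.sum_congr rfl fun r _ => ?_
  simp only [fourierFun, Equiv.apply_symm_apply]
  rw [sum_norm_sq_of_orthogonal (fun o y => e (-(o * y))) (Fintype.card F : ℝ)
    (fun y y' => sum_addChar_mul_conj he y y'), Finset.mul_sum]
  refine Finset.sum_congr rfl fun y _ => ?_
  rw [norm_div, div_pow, Complex.norm_real, Real.norm_eq_abs, sq_abs, Real.sq_sqrt hF.le,
    mul_div_cancel₀ _ hF.ne']

/-- The quantum Fourier transform on the workspace register. -/
noncomputable def registerFourier {e : AddChar F ℂ} (he : e.IsPrimitive) :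
    QState X F (Fintype.card F) ≃ₗᵢ[ℂ] QState X F (Fintype.card F) :=
  LinearIsometry.toLinearIsometryEquiv
    { toFun := fourierFun e
      map_add' := fun ψ ψ' => by
        ext b
        simp [fourierFun, add_div, mul_add, Finset.sum_add_distrib]
      map_smul' := fun c ψ => by
        ext b
        simp only [fourierFun, WithLp.ofLp_smul, Pi.smul_apply, smul_eq_mul, RingHom.id_apply,
          Finset.mul_sum]
        exact Finset.sum_congr rfl fun y _ => by ring
      norm_map' := norm_fourierFun he } rfl

lemma registerFourier_apply {e : AddChar F ℂ} (he : e.IsPrimitive) (ψ : QState X F (Fintype.card F)) :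
    registerFourier he ψ = fourierFun e ψ := rfl

/-- The Fourier transform in round `q`, the identity in all other rounds. -/
noncomputable def finalFourier {e : AddChar F ℂ} (he : e.IsPrimitive) (q i : ℕ) :
    QState X F (Fintype.card F) ≃ₗᵢ[ℂ] QState X F (Fintype.card F) :=
  if i = q then registerFourier he else LinearIsometryEquiv.refl ℂ _

/-- The algorithm which follows the query sequences `p 0 y, p 1 y, …` in superposition over `y`
and applies the Fourier transform after the query number `q`. -/
noncomputable def pathAlgorithm {e : AddChar F ℂ} (he : e.IsPrimitive) (q : ℕ)
    (p : ℕ → F → X × AddChar F ℂ) (θ : F → ℂ) (hθ : ∑ y, ‖θ y‖ ^ 2 = 1) :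
    QAlgorithm X F F where
  workDim := Fintype.card F
  -- For `q = 0` the Fourier transform has to be part of the initial state.
  init := finalFourier he q 0 (pathState (p 0) θ)
  norm_init := by
    rw [LinearIsometryEquiv.norm_map, ← sq_eq_sq₀ (norm_nonneg _) zero_le_one,
      norm_pathState_sq, hθ, one_pow]
  step i := (LinearIsometryEquiv.piLpCongrLeft 2 ℂ ℂ (pathPerm (p i) (p (i + 1)))).trans
    (finalFourier he q (i + 1))
  decode b := label F b.2.2

lemma pathAlgorithm_run {e : AddChar F ℂ} (he : e.IsPrimitive) (q : ℕ)
    (p : ℕ → F → X × AddChar F ℂ) (θ : F → ℂ) (hθ : ∑ y, ‖θ y‖ ^ 2 = 1) (A : X → F) (i : ℕ)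
    (hi : i ≤ q) :
    (pathAlgorithm he q p θ hθ).run A i = finalFourier he q i
      (pathState (p i) fun y => (∏ j ∈ Finset.range i, (p j y).2 (A (p j y).1)) * θ y) := by
  induction i with
  | zero => simp [QAlgorithm.run, pathAlgorithm]
  | succ i ih =>
    have key : ∀ ψ : QState X F (Fintype.card F), ψ = finalFourier he q i
        (pathState (p i) fun y => (∏ j ∈ Finset.range i, (p j y).2 (A (p j y).1)) * θ y) →
        finalFourier he q (i + 1) (LinearIsometryEquiv.piLpCongrLeft 2 ℂ ℂ
          (pathPerm (p i) (p (i + 1))) (phaseQuery A ψ)) = finalFourier he q (i + 1)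
        (pathState (p (i + 1)) fun y =>
          (∏ j ∈ Finset.range (i + 1), (p j y).2 (A (p j y).1)) * θ y) := by
      rintro _ rfl
      have h : finalFourier (X := X) he q i = LinearIsometryEquiv.refl ℂ _ :=
        if_neg (by omega)
      rw [h, LinearIsometryEquiv.coe_refl, id, phaseQuery_pathState,
        pathPerm_pathState]
      congr 2
      ext y
      rw [Finset.prod_range_succ]
      ring
    exact key _ (ih (by omega))

end PathAlgorithm

/-! ### An algorithm attaining the largest fiber -/

section LowerBound

variable {F : Type*} [Field F] [Fintype F] [DecidableEq F]

lemma addChar_map_sum {ι A M : Type*} [AddCommMonoid A] [CommMonoid M] (e : AddChar A M)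
    (s : Finset ι) (f : ι → A) : e (∑ i ∈ s, f i) = ∏ i ∈ s, e (f i) := by
  classical
  induction s using Finset.induction_on with
  | empty => simp
  | insert i s hi ih =>
    rw [Finset.sum_insert hi, Finset.prod_insert hi, AddChar.map_add_eq_mul, ih]

/-- A sparse weight is a sum of `q` point masses, and the sequence of these can be continued
trivially. -/
lemma Sparse.exists_sequence {q : ℕ} {f : F → F} (hf : Sparse q f) :
    ∃ (c : ℕ → F) (x : ℕ → {x : F // x ≠ 0}),
      (∀ i, q ≤ i → c i = 0 ∧ x i = ⟨1, one_ne_zero⟩) ∧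
      ∀ g : F → F, ∑ i ∈ Finset.range q, c i * g (x i) = ∑ y, f y * g y := by
  induction q generalizing f with
  | zero =>
    refine ⟨fun _ => 0, fun _ => ⟨1, one_ne_zero⟩, fun _ _ => ⟨rfl, rfl⟩, fun g => ?_⟩
    have h0 : fsupp f = ∅ := Finset.card_eq_zero.1 (Nat.le_zero.1 hf.2)
    rw [Finset.range_zero, Finset.sum_empty]
    symm
    refine Finset.sum_eq_zero fun y _ => ?_
    have : y ∉ fsupp f := by simp [h0]
    rw [mem_fsupp, not_not] at this
    rw [this, zero_mul]
  | succ q ih =>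
    by_cases hle : #(fsupp f) ≤ q
    · obtain ⟨c, x, h1, h2⟩ := ih ⟨hf.1, hle⟩
      refine ⟨c, x, fun i hi => h1 i (by omega), fun g => ?_⟩
      rw [Finset.sum_range_succ, h2, (h1 q le_rfl).1, zero_mul, add_zero]
    · obtain ⟨y₀, hy₀⟩ : (fsupp f).Nonempty := by
        rw [← Finset.card_pos]; omega
      have hy0 : y₀ ≠ 0 := by
        rintro rfl
        exact mem_fsupp.1 hy₀ hf.1
      have hs : Sparse q (Function.update f y₀ 0) := by
        refine ⟨by rw [Function.update_of_ne hy0.symm]; exact hf.1, ?_⟩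
        have hsub : fsupp (Function.update f y₀ 0) ⊆ (fsupp f).erase y₀ := by
          intro y hy
          rw [mem_fsupp] at hy
          have hne : y ≠ y₀ := by
            rintro rfl
            simp at hy
          rw [Function.update_of_ne hne] at hy
          exact Finset.mem_erase.2 ⟨hne, mem_fsupp.2 hy⟩
        refine (Finset.card_le_card hsub).trans ?_
        rw [Finset.card_erase_of_mem hy₀]
        have := hf.2
        omega
      obtain ⟨c, x, h1, h2⟩ := ih hs
      refine ⟨Function.update c q (f y₀), Function.update x q ⟨y₀, hy0⟩, fun i hi => ?_,
        fun g => ?_⟩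
      · rw [Function.update_of_ne (by omega), Function.update_of_ne (by omega)]
        exact h1 i (by omega)
      · rw [Finset.sum_range_succ, Function.update_self, Function.update_self,
          Finset.sum_congr rfl (g := fun i => c i * g (x i)), h2]
        · rw [← Finset.add_sum_erase _ _ (mem_univ y₀),
            ← Finset.add_sum_erase (a := y₀) univ (fun y => f y * g y) (mem_univ y₀),
            Function.update_self, zero_mul, zero_add, add_comm]
          congr 1
          refine Finset.sum_congr rfl fun y hy => ?_
          rw [Function.update_of_ne (Finset.mem_erase.1 hy).1]
        · intro i hi
          have : i ≠ q := (Finset.mem_range.1 hi).ne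
          rw [Function.update_of_ne this, Function.update_of_ne this]

/-- Entry `q` describes the query register after the last query. It is the same for all `y`, so that
the branches can interfere. -/
lemma exists_query_sequences (d q : ℕ) (u : Fin d → F) (y : F) :
    ∃ (c : ℕ → F) (x : ℕ → {x : F // x ≠ 0}), c q = 0 ∧ x q = ⟨1, one_ne_zero⟩ ∧
      (y ∈ fiber d q u → ∀ a : Fin (d + 1) → F,
        ∑ i ∈ Finset.range q, c i * (polyOfCoeffs a).eval (x i : F) =
          (Fin.cons y u : Fin (d + 1) → F) ⬝ᵥ a) := by
  by_cases hy : y ∈ fiber d q u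
  · obtain ⟨f, hf, h0, hm⟩ := mem_fiber.1 hy
    obtain ⟨c, x, h1, h2⟩ := hf.exists_sequence
    refine ⟨c, x, (h1 q le_rfl).1, (h1 q le_rfl).2, fun _ a => ?_⟩
    rw [h2 fun z => (polyOfCoeffs a).eval z]
    simp_rw [eval_polyOfCoeffs, dotProduct, Finset.mul_sum]
    rw [Finset.sum_comm]
    refine Finset.sum_congr rfl fun j _ => ?_
    have hj : moment f j = (Fin.cons y u : Fin (d + 1) → F) j := by
      refine Fin.cases ?_ (fun j => ?_) j
      · simpa using h0
      · simpa using hm j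
    rw [← hj, moment, Finset.sum_mul]
    exact Finset.sum_congr rfl fun z _ => by ring
  · exact ⟨fun _ => 0, fun _ => ⟨1, one_ne_zero⟩, rfl, rfl, fun h => absurd h hy⟩

theorem exists_le_extrapolationProb (d q : ℕ) :
    ∃ Q : QAlgorithm {x : F // x ≠ 0} F F,
      (maxFiber F d q : ℝ) / Fintype.card F ≤ extrapolationProb d q Q := by
  obtain ⟨e, he⟩ := exists_primitive_addChar F
  obtain ⟨u, hu⟩ := exists_card_fiber_eq (F := F) d q
  choose c x hc hx hcx using exists_query_sequences d q u
  have hF : (0 : ℝ) < Fintype.card F := by exact_mod_cast Fintype.card_pos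
  have hM : (0 : ℝ) < maxFiber F d q := by exact_mod_cast maxFiber_pos d q
  set N : ℝ := (Fintype.card F : ℝ) with hN
  set M : ℝ := (maxFiber F d q : ℝ) with hMdef
  set θ : F → ℂ := fun y => if y ∈ fiber d q u then ((Real.sqrt M)⁻¹ : ℂ) else 0 with hθdef
  have hθ : ∑ y, ‖θ y‖ ^ 2 = 1 := by
    have : ∀ y, ‖θ y‖ ^ 2 = if y ∈ fiber d q u then M⁻¹ else 0 := by
      intro y
      simp only [hθdef]
      split_ifs
      · rw [norm_inv, Complex.norm_real, Real.norm_eq_abs, inv_pow, sq_abs, Real.sq_sqrt hM.le]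
      · simp
    simp_rw [this]
    rw [Finset.sum_ite_mem, univ_inter, Finset.sum_const, hu, nsmul_eq_mul, ← hMdef,
      mul_inv_cancel₀ hM.ne']
  refine ⟨pathAlgorithm he q (fun i y => (x y i, e.mulShift (c y i))) θ hθ, ?_⟩
  have key : ∀ a : Fin (d + 1) → F, M / N ≤
      (pathAlgorithm he q (fun i y => (x y i, e.mulShift (c y i))) θ hθ).outputProb q (fun x => (polyOfCoeffs a).eval (x : F)) ((polyOfCoeffs a).eval 0) := by
    intro a
    rw [eval_zero_polyOfCoeffs, QAlgorithm.outputProb]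
    -- This single correct outcome suffices: the `M` branches of the fiber add up in phase to an
    -- amplitude of modulus `M / √(M N)`, whose square is `M / N`.
    set b : QBasis {x : F // x ≠ 0} F (Fintype.card F) :=
      (⟨1, one_ne_zero⟩, e.mulShift 0, (label F).symm (a 0)) with hb
    have hdec : label F b.2.2 = a 0 := Equiv.apply_symm_apply _ _
    refine le_trans ?_ (Finset.single_le_sum
      (f := fun b' => if (pathAlgorithm he q (fun i y => (x y i, e.mulShift (c y i))) θ hθ).decode
          b' = a 0 then ‖(pathAlgorithm he q (fun i y => (x y i, e.mulShift (c y i))) θ hθ).run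
            (fun x => (polyOfCoeffs a).eval (x : F)) q b'‖ ^ 2 else 0)
      (fun b' _ => by positivity) (mem_univ b))
    have hrun := pathAlgorithm_run he q (fun i y => (x y i, e.mulShift (c y i))) θ hθ
      (fun x => (polyOfCoeffs a).eval (x : F)) q le_rfl
    have hval : (finalFourier he q q (pathState (fun y => (x y q, e.mulShift (c y q))) fun y =>
        (∏ j ∈ Finset.range q, e.mulShift (c y j) ((polyOfCoeffs a).eval (x y j : F))) * θ y)) b =
        e (u ⬝ᵥ Fin.tail a) * (M / ((Real.sqrt M : ℂ) * (Real.sqrt N : ℂ))) := by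
      rw [finalFourier, if_pos rfl, registerFourier_apply]
      simp only [fourierFun, pathState, hb, hc, hx, Equiv.apply_symm_apply, if_true]
      have : ∀ y, e (-(a 0 * y)) * ((∏ j ∈ Finset.range q,
          e.mulShift (c y j) ((polyOfCoeffs a).eval (x y j : F))) * θ y /
            (Real.sqrt (Fintype.card F) : ℂ)) =
          if y ∈ fiber d q u then
            e (u ⬝ᵥ Fin.tail a) * ((Real.sqrt M : ℂ) * (Real.sqrt N : ℂ))⁻¹ else 0 := by
        intro y
        by_cases hy : y ∈ fiber d q u
        · have h1 := hcx y hy a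
          simp_rw [AddChar.mulShift_apply]
          rw [← addChar_map_sum, h1, if_pos hy]
          conv_lhs => rw [← Fin.cons_self_tail a]
          rw [cons_dotProduct_fin_cons, Fin.cons_zero]
          simp only [hθdef, if_pos hy]
          rw [← mul_div_assoc, ← mul_assoc, ← AddChar.map_add_eq_mul,
            show -(a 0 * y) + (y * a 0 + u ⬝ᵥ Fin.tail a) = u ⬝ᵥ Fin.tail a by ring, mul_inv,
            div_eq_mul_inv, mul_assoc]
        · simp [hθdef, hy]
      rw [Finset.sum_congr rfl fun y _ => this y, Finset.sum_ite_mem, univ_inter,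
        Finset.sum_const, hu, nsmul_eq_mul]
      have hMc : ((maxFiber F d q : ℕ) : ℂ) = (M : ℂ) := by rw [hMdef, Complex.ofReal_natCast]
      rw [hMc]
      ring
    refine le_of_eq (((if_pos hdec).trans ?_).symm)
    rw [(congrArg (fun ψ : QState {x : F // x ≠ 0} F (Fintype.card F) => ψ b) hrun).trans hval,
      norm_mul, AddChar.norm_apply, one_mul, norm_div, norm_mul, Complex.norm_real,
      Complex.norm_real, Complex.norm_real, div_pow, mul_pow]
    simp only [Real.norm_eq_abs, sq_abs]
    rw [Real.sq_sqrt hM.le, Real.sq_sqrt hF.le]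
    field_simp
  rw [extrapolationProb, le_div_iff₀ (by exact_mod_cast Fintype.card_pos)]
  refine le_trans (le_of_eq ?_) (Finset.card_nsmul_le_sum _ _ _ fun a _ => key a)
  rw [nsmul_eq_mul, Finset.card_univ, mul_comm]

theorem isMaxExtrapolationProb_maxFiber (d q : ℕ) :
    IsMaxExtrapolationProb F d q ((maxFiber F d q : ℝ) / Fintype.card F) := by
  obtain ⟨Q, hQ⟩ := exists_le_extrapolationProb (F := F) d q
  refine ⟨⟨Q, le_antisymm (extrapolationProb_le d q Q) hQ⟩, ?_⟩
  rintro _ ⟨Q', rfl⟩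
  exact extrapolationProb_le d q Q'

end LowerBound

theorem theorem5p5 {F : Type*} [Field F] [Fintype F] [DecidableEq F] (d q : ℕ) :
    ∃ P : ℝ, IsMaxExtrapolationProb F d q P ∧
      (2 * q ≤ d → P = 1 / (Fintype.card F : ℝ)) ∧
      (2 * q = d + 1 → q ≤ Fintype.card F - 1 →
        P ≤ (((Fintype.card F - 1) / q : ℕ) : ℝ) / (Fintype.card F : ℝ)) ∧
      (2 * q = d + 1 → q ∣ Fintype.card F - 1 →
        P = (((Fintype.card F - 1) / q : ℕ) : ℝ) / (Fintype.card F : ℝ)) ∧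
      (d + 2 ≤ 2 * q →
        1 - (((d / 2 + 1)! + d + 1 : ℕ) : ℝ) / (Fintype.card F : ℝ) ≤ P) := by
  have hF : (0 : ℝ) < Fintype.card F := by exact_mod_cast Fintype.card_pos
  refine ⟨_, isMaxExtrapolationProb_maxFiber d q, fun h => ?_, fun h hq => ?_, fun h hq => ?_,
    fun h => ?_⟩
  · rw [maxFiber_eq_one h, Nat.cast_one]
  · gcongr
    exact maxFiber_le_div h hq
  · have hle : q ≤ Fintype.card F - 1 :=
      Nat.le_of_dvd (Nat.sub_pos_of_lt Fintype.one_lt_card) hq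
    rw [le_antisymm (maxFiber_le_div h hle) (div_le_maxFiber h hq)]
  · have h1 : (Fintype.card F : ℝ) ≤ maxFiber F d q + ((d / 2 + 1)! + d + 1 : ℕ) := by
      exact_mod_cast card_le_maxFiber_add h
    rw [sub_le_iff_le_add, ← add_div, le_div_iff₀ hF, one_mul]
    exact h1
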